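/- Let $\mathcal H$ be a complex Hilbert space with scalar product $\langle\cdot,\cdot\rangle$ (antilinear in the first argument), and let $H$ be a self-adjoint operator in $\mathcal H$ with domain $\mathcal G^2$ and form domain $\mathcal G^1=D(|H|^{1/2})$, both equipped with their graph norms. Let $\mathcal G^{-1}$ be the topological anti-dual of $\mathcal G^1$, so that $\mathcal G^2\subset\mathcal G^1\subset\mathcal H\subset\mathcal G^{-1}$; every symmetric operator in $\mathscr B(\mathcal G^2,\mathcal H)$ is identified with its unique continuous extension in $\mathscr B(\mathcal G^1,\mathcal G^{-1})$, and for non-real $z$ the resolvent $(H-z)^{-1}$ with its continuous extension in $\mathscr B(\mathcal G^{-1},\mathcal G^1)$. Let $W_t=e^{itA}$, $t\in\mathbb R$, be a strongly continuous unitary group in $\mathcal H$ with self-adjoint generator $A$, such that $W_t\mathcal G^2\subset\mathcal G^2$ for all $t$ (then also $W_t\mathcal G^1\subset\mathcal G^1$). Assume that $H\in C^1(A;\mathcal G^2,\mathcal H)$, i.e. $t\mapsto W_{-t}HW_tf\in\mathcal H$ is differentiable for every $f\in\mathcal G^2$, and let $[iH,A]\in\mathscr B(\mathcal G^2,\mathcal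 H)$ be the derivative at $t=0$, which is symmetric. Assume that there are constants $c_1\ge 0$ and $c_2>0$ such that $$S:=-c_1H+[iH,A]>0\qquad\text{and}\qquad [iH,A]\ge -c_2,$$ i.e. $\langle f,Sf\rangle>0$ for all $f\in\mathcal G^1\setminus\{0\}$ and $\langle f,[iH,A]f\rangle\ge -c_2\|f\|^2$ for all $f\in\mathcal G^1$. Let $\mathcal S$ be the completion of $\mathcal G^1$ in the norm $\|f\|_{\mathcal S}=\langle f,Sf\rangle^{1/2}$ and let $\mathcal S^*$ be its topological anti-dual, which embeds in $\mathcal G^{-1}$ by restriction of functionals to $\mathcal G^1$. Assume that $\{W_t\}$ extends to a $C_0$-group in $\mathcal S$ (equivalently, restricts to a $C_0$-group in $\mathcal S^*$); these groups are still denoted by $W_t$. Assume finally that $[iH,A]$ extends to an element of $C^1(A;\mathcal S,\mathcal S^*)$, i.e. to an operator $K\in\mathscr B(\mathcal S,\mathcal S^*)$ such that $t\mapsto W_{-t}KW_tf\in\mathcal S^*$ is differentiable for every $f\in\mathcal S$. Let $D(A,\mathcal S^*)$ be the domain of the generator of the group in $\mathcal S^*$, with the graph norm, and let $\mathcal E:=(D(A,\mathcal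 S^*),\mathcal S^*)_{1/2,1}$ be the real interpolation space, i.e. the set of all $f\in\mathcal S^*$ for which $$\|f\|_{\mathcal E}:=\int_0^\infty t^{-1/2}\inf_{g\in D(A,\mathcal S^*)}\big(\|f-g\|_{\mathcal S^*}+t\,\|g\|_{D(A,\mathcal S^*)}\big)\,\frac{dt}{t}<\infty .$$ Then there exists $c<\infty$ such that $$|\langle f,(H-\lambda\mp i\mu)^{-1}f\rangle|\le c\,\|f\|_{\mathcal E}^2$$ for all $\lambda\in\mathbb R$ with $c_1\lambda\ge 0$, all $\mu>0$, all $f\in\mathcal E$ and both signs. Here $\langle\cdot,\cdot\rangle$ is the duality between $\mathcal G^{-1}$ and $\mathcal G^1$. (Thus the estimate is uniform in $\lambda\in\mathbb R$ if $c_1=0$ and in $\lambda\in[0,\infty)$ if $c_1>0$.) -/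

import Mathlib

noncomputable section

open Complex Filter Topology MeasureTheory
open scoped InnerProductSpace ComplexOrder ComplexConjugate

namespace ConjugateOperator

section Resolvent

set_option linter.unusedSectionVars false

variable {𝓗 : Type*} [NormedAddCommGroup 𝓗] [InnerProductSpace ℂ 𝓗] [CompleteSpace 𝓗]
variable {H : 𝓗 →ₗ.[ℂ] 𝓗}

theorem symm_of_isSelfAdjoint (hH : IsSelfAdjoint H) (x y : H.domain) :
    ⟪H x, (y : 𝓗)⟫_ℂ = ⟪(x : 𝓗), H y⟫_ℂ := by
  have h := LinearPMap.adjoint_isFormalAdjoint hH.dense_domain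
  rw [LinearPMap.isSelfAdjoint_def] at hH
  rw [hH] at h
  exact h x y

/-- The operator `H - z` on the domain of `H`. -/
def shift (H : 𝓗 →ₗ.[ℂ] 𝓗) (z : ℂ) : H.domain →ₗ[ℂ] 𝓗 := H.toFun - z • H.domain.subtype

theorem shift_apply (z : ℂ) (f : H.domain) : shift H z f = H f - z • (f : 𝓗) := rfl

theorem inner_shift (hH : IsSelfAdjoint H) (z : ℂ) (f g : H.domain) :
    ⟪shift H z f, (g : 𝓗)⟫_ℂ = ⟪(f : 𝓗), shift H (conj z) g⟫_ℂ := by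
  rw [shift_apply, shift_apply, inner_sub_left, inner_sub_right, symm_of_isSelfAdjoint hH,
    inner_smul_left, inner_smul_right]

theorem bound_shift (hH : IsSelfAdjoint H) (z : ℂ) (f : H.domain) :
    |z.im| * ‖(f : 𝓗)‖ ≤ ‖shift H z f‖ := by
  have h1 : (⟪(f : 𝓗), H f⟫_ℂ).im = 0 := by
    have := symm_of_isSelfAdjoint hH f f
    rw [← inner_conj_symm] at this
    exact Complex.conj_eq_iff_im.1 this
  have h2 : (⟪(f : 𝓗), shift H z f⟫_ℂ).im = - (z.im * ‖(f : 𝓗)‖ ^ 2) := by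
    rw [shift_apply, inner_sub_right, inner_smul_right, inner_self_eq_norm_sq_to_K, Complex.sub_im,
      h1]
    simp [← Complex.ofReal_pow]
  have h3 : |z.im| * ‖(f : 𝓗)‖ ^ 2 ≤ ‖(f : 𝓗)‖ * ‖shift H z f‖ := by
    calc |z.im| * ‖(f : 𝓗)‖ ^ 2 = |(⟪(f : 𝓗), shift H z f⟫_ℂ).im| := by
          rw [h2, abs_neg, abs_mul, abs_of_nonneg (sq_nonneg ‖(f : 𝓗)‖)]
      _ ≤ _ := (Complex.abs_im_le_norm _).trans (norm_inner_le_norm _ _)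
  rcases (norm_nonneg (f : 𝓗)).eq_or_lt with h | h
  · rw [← h]; simp
  · nlinarith

theorem shift_injective (hH : IsSelfAdjoint H) {z : ℂ} (hz : z.im ≠ 0) :
    Function.Injective (shift H z) := by
  rw [injective_iff_map_eq_zero]
  intro f hf
  have := bound_shift hH z f
  rw [hf, norm_zero] at this
  have h0 : 0 < |z.im| := abs_pos.2 hz
  have : ‖(f : 𝓗)‖ = 0 := by nlinarith [norm_nonneg (f : 𝓗)]
  simpa using this

theorem shift_surjective (hH : IsSelfAdjoint H) {z : ℂ} (hz : z.im ≠ 0) :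
    Function.Surjective (shift H z) := by
  have h0 : 0 < |z.im| := abs_pos.2 hz
  rw [← LinearMap.range_eq_top]
  have hcl : IsClosed ((LinearMap.range (shift H z) : Submodule ℂ 𝓗) : Set 𝓗) := by
    rw [← isSeqClosed_iff_isClosed]
    intro u y hu huy
    choose x hx using hu
    have hc : CauchySeq (fun n => (x n : 𝓗)) := by
      rw [Metric.cauchySeq_iff']
      intro ε hε
      obtain ⟨N, hN⟩ := Metric.cauchySeq_iff'.1 huy.cauchySeq (|z.im| * ε) (by positivity)
      refine ⟨N, fun n hn => ?_⟩
      have h1 := hN n hn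
      rw [dist_eq_norm, ← hx, ← hx, ← map_sub] at h1
      have h2 := bound_shift hH z (x n - x N)
      rw [dist_eq_norm]
      have : |z.im| * ‖(x n : 𝓗) - x N‖ < |z.im| * ε := lt_of_le_of_lt (by simpa using h2) h1
      exact lt_of_mul_lt_mul_left this h0.le
    obtain ⟨x₀, hx₀⟩ := cauchySeq_tendsto_of_complete hc
    have hg : ((x₀, y + z • x₀) : 𝓗 × 𝓗) ∈ H.graph := by
      have hcg : IsClosed (H.graph : Set (𝓗 × 𝓗)) := hH.isClosed
      refine hcg.mem_of_tendsto (b := atTop) (f := fun n => ((x n : 𝓗), H (x n))) ?_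
        (Eventually.of_forall fun n => H.mem_graph (x n))
      refine hx₀.prodMk_nhds ?_
      have : (fun n => H (x n)) = fun n => u n + z • (x n : 𝓗) := by
        funext n; rw [← hx, shift_apply]; abel
      rw [this]
      exact huy.add (hx₀.const_smul z)
    rw [LinearPMap.mem_graph_iff] at hg
    obtain ⟨w, hw1, hw2⟩ := hg
    refine ⟨w, ?_⟩
    simp only at hw1 hw2
    rw [shift_apply, hw2, hw1]; abel
  have : CompleteSpace (LinearMap.range (shift H z)) := hcl.completeSpace_coe
  rw [← Submodule.orthogonal_eq_bot_iff, Submodule.eq_bot_iff]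
  intro v hv
  rw [Submodule.mem_orthogonal'] at hv
  have hw : ∀ x : H.domain, ⟪(conj z) • v, (x : 𝓗)⟫_ℂ = ⟪v, H x⟫_ℂ := by
    intro x
    have := hv _ ⟨x, rfl⟩
    rw [shift_apply, inner_sub_right, inner_smul_right, sub_eq_zero] at this
    rw [this, inner_smul_left, Complex.conj_conj]
  have hmem : v ∈ H.adjoint.domain := LinearPMap.mem_adjoint_domain_of_exists v ⟨_, hw⟩
  have hval : H.adjoint ⟨v, hmem⟩ = conj z • v :=
    LinearPMap.adjoint_apply_eq hH.dense_domain ⟨v, hmem⟩ hw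
  have hgr : ((v, conj z • v) : 𝓗 × 𝓗) ∈ H.adjoint.graph := by
    rw [← hval]; exact H.adjoint.mem_graph ⟨v, hmem⟩
  rw [(LinearPMap.isSelfAdjoint_def.1 hH), LinearPMap.mem_graph_iff] at hgr
  obtain ⟨w, hw1, hw2⟩ := hgr
  have : shift H (conj z) w = 0 := by rw [shift_apply, hw2, hw1]; simp
  have h3 := bound_shift hH (conj z) w
  rw [this, norm_zero, hw1, Complex.conj_im, abs_neg] at h3
  have : ‖v‖ = 0 := by simp only at h3; nlinarith [norm_nonneg v]
  simpa using this

/-- `H - z` as a bijection from the domain of `H` onto the Hilbert space, `z` not real. -/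
def shiftEquiv (hH : IsSelfAdjoint H) {z : ℂ} (hz : z.im ≠ 0) : H.domain ≃ₗ[ℂ] 𝓗 :=
  LinearEquiv.ofBijective (shift H z) ⟨shift_injective hH hz, shift_surjective hH hz⟩

/-- The resolvent `(H - z)⁻¹` of a self-adjoint operator `H` at a non-real `z`,
as a bounded operator. -/
def resolventOp (hH : IsSelfAdjoint H) (z : ℂ) (hz : z.im ≠ 0) : 𝓗 →L[ℂ] 𝓗 :=
  LinearMap.mkContinuous (H.domain.subtype ∘ₗ (shiftEquiv hH hz).symm.toLinearMap) (|z.im|⁻¹) (by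
    intro x
    have h := bound_shift hH z ((shiftEquiv hH hz).symm x)
    have h2 : shift H z ((shiftEquiv hH hz).symm x) = x := (shiftEquiv hH hz).apply_symm_apply x
    rw [h2] at h
    have h0 : 0 < |z.im| := abs_pos.2 hz
    rw [inv_mul_eq_div, le_div_iff₀ h0, mul_comm]
    exact h)

theorem resolventOp_mem (hH : IsSelfAdjoint H) {z : ℂ} (hz : z.im ≠ 0) (x : 𝓗) :
    resolventOp hH z hz x ∈ H.domain := ((shiftEquiv hH hz).symm x).2

theorem shift_resolventOp (hH : IsSelfAdjoint H) {z : ℂ} (hz : z.im ≠ 0) (x : 𝓗) :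
    shift H z ⟨resolventOp hH z hz x, resolventOp_mem hH hz x⟩ = x :=
  (shiftEquiv hH hz).apply_symm_apply x

theorem resolventOp_shift (hH : IsSelfAdjoint H) {z : ℂ} (hz : z.im ≠ 0) (f : H.domain) :
    resolventOp hH z hz (shift H z f) = f :=
  congrArg Subtype.val ((shiftEquiv hH hz).symm_apply_apply f)

theorem conj_im_ne {z : ℂ} (hz : z.im ≠ 0) : (conj z).im ≠ 0 := by simpa using hz

theorem resolventOp_adjoint (hH : IsSelfAdjoint H) {z : ℂ} (hz : z.im ≠ 0) :
    ContinuousLinearMap.adjoint (resolventOp hH z hz) =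
      resolventOp hH (conj z) (conj_im_ne hz) := by
  symm
  rw [ContinuousLinearMap.eq_adjoint_iff]
  intro x y
  have h := inner_shift hH (conj z) ⟨_, resolventOp_mem hH (conj_im_ne hz) x⟩
    ⟨_, resolventOp_mem hH hz y⟩
  rw [shift_resolventOp] at h
  rw [h]
  simp only [Complex.conj_conj]
  rw [shift_resolventOp]

theorem resolventOp_sub (hH : IsSelfAdjoint H) {z w : ℂ} (hz : z.im ≠ 0) (hw : w.im ≠ 0) (x : 𝓗) :
    resolventOp hH z hz x = resolventOp hH w hw x +
      (z - w) • resolventOp hH z hz (resolventOp hH w hw x) := by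
  have h : x = shift H z ⟨resolventOp hH w hw x, resolventOp_mem hH hw x⟩ +
      (z - w) • resolventOp hH w hw x := by
    conv_lhs => rw [← shift_resolventOp hH hw x]
    rw [shift_apply, shift_apply]
    module
  conv_lhs => rw [h]
  rw [map_add, map_smul, resolventOp_shift]

theorem resolventOp_commute (hH : IsSelfAdjoint H) {z w : ℂ} (hz : z.im ≠ 0) (hw : w.im ≠ 0) :
    Commute (resolventOp hH z hz) (resolventOp hH w hw) := by
  by_cases hzw : z = w
  · subst hzw; exact Commute.refl _
  ext x
  have h1 := resolventOp_sub hH hz hw x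
  have h2 := resolventOp_sub hH hw hz x
  have h3 : (z - w) • (resolventOp hH z hz (resolventOp hH w hw x)
      - resolventOp hH w hw (resolventOp hH z hz x)) = 0 := by
    have e1 : (z - w) • resolventOp hH z hz (resolventOp hH w hw x)
        = resolventOp hH z hz x - resolventOp hH w hw x := by
      rw [eq_sub_iff_add_eq, add_comm]; exact h1.symm
    have e2 : (w - z) • resolventOp hH w hw (resolventOp hH z hz x)
        = resolventOp hH w hw x - resolventOp hH z hz x := by
      rw [eq_sub_iff_add_eq, add_comm]; exact h2.symm
    rw [smul_sub, e1, ← neg_sub w z, neg_smul, e2]; abel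
  rcases smul_eq_zero.1 h3 with h | h
  · exact absurd (sub_eq_zero.1 h) hzw
  · exact sub_eq_zero.1 h

end Resolvent

section FormDomain

set_option linter.unusedSectionVars false

variable {𝓗 : Type*} [NormedAddCommGroup 𝓗] [InnerProductSpace ℂ 𝓗] [CompleteSpace 𝓗]
variable {H : 𝓗 →ₗ.[ℂ] 𝓗}

theorem I_im_ne : Complex.I.im ≠ 0 := by simp

/-- The resolvent `(H - i)⁻¹`. -/
def resolventI (hH : IsSelfAdjoint H) : 𝓗 →L[ℂ] 𝓗 :=
  resolventOp hH Complex.I I_im_ne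

/-- The bounded positive operator `⟨H⟩⁻¹ = (1 + H²)^(-1/2)`, that is, the positive square root
of `(1 + H²)⁻¹ = ((H - i)⁻¹)* (H - i)⁻¹`. -/
def invBracket (hH : IsSelfAdjoint H) : 𝓗 →L[ℂ] 𝓗 :=
  CFC.sqrt (star (resolventI hH) * resolventI hH)

/-- The bounded positive operator `⟨H⟩^(-1/2) = (1 + H²)^(-1/4)`. -/
def invSqrtBracket (hH : IsSelfAdjoint H) : 𝓗 →L[ℂ] 𝓗 := CFC.sqrt (invBracket hH)

/-- Range inclusion from a norm inequality for the adjoints. -/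
theorem exists_factor {A C : 𝓗 →L[ℂ] 𝓗} (hC : Function.Injective C) (k : ℝ)
    (h : ∀ v, ‖star A v‖ ≤ k * ‖star C v‖) : ∃ D : 𝓗 →L[ℂ] 𝓗, A = C * D := by
  have hd : DenseRange (star C : 𝓗 →L[ℂ] 𝓗) := by
    have h1 : (LinearMap.range (star C : 𝓗 →L[ℂ] 𝓗).toLinearMap)ᗮ = ⊥ := by
      rw [Submodule.eq_bot_iff]
      intro v hv
      rw [Submodule.mem_orthogonal] at hv
      apply hC
      rw [map_zero, ← inner_self_eq_zero (𝕜 := ℂ)]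
      have := hv (star C (C v)) ⟨C v, rfl⟩
      rwa [ContinuousLinearMap.star_eq_adjoint, ContinuousLinearMap.adjoint_inner_left] at this
    have h2 := Submodule.topologicalClosure_eq_top_iff.2 h1
    have h3 := Submodule.dense_iff_topologicalClosure_eq_top.2 h2
    exact h3
  let Z := (star A : 𝓗 →L[ℂ] 𝓗).toLinearMap.extendOfNorm (star C : 𝓗 →L[ℂ] 𝓗).toLinearMap
  have hZ : ∀ v, Z (star C v) = star A v := fun v =>
    LinearMap.extendOfNorm_eq (f := (star A : 𝓗 →L[ℂ] 𝓗).toLinearMap)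
      (e := (star C : 𝓗 →L[ℂ] 𝓗).toLinearMap) hd ⟨k, h⟩ v
  refine ⟨star Z, ?_⟩
  have : star A = Z * star C := by ext v; exact (hZ v).symm
  rw [← star_star A, this, star_mul, star_star]

theorem resolventI_normal (hH : IsSelfAdjoint H) :
    star (resolventI hH) * resolventI hH = resolventI hH * star (resolventI hH) := by
  rw [ContinuousLinearMap.star_eq_adjoint, resolventI, resolventOp_adjoint]
  exact resolventOp_commute _ _ _

theorem invBracket_nonneg (hH : IsSelfAdjoint H) : 0 ≤ invBracket hH := CFC.sqrt_nonneg _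

theorem invSqrtBracket_nonneg (hH : IsSelfAdjoint H) : 0 ≤ invSqrtBracket hH := CFC.sqrt_nonneg _

theorem star_invBracket (hH : IsSelfAdjoint H) : star (invBracket hH) = invBracket hH :=
  (IsSelfAdjoint.of_nonneg (invBracket_nonneg hH)).star_eq

theorem star_invSqrtBracket (hH : IsSelfAdjoint H) :
    star (invSqrtBracket hH) = invSqrtBracket hH :=
  (IsSelfAdjoint.of_nonneg (invSqrtBracket_nonneg hH)).star_eq

theorem invBracket_mul_self (hH : IsSelfAdjoint H) :
    invBracket hH * invBracket hH = star (resolventI hH) * resolventI hH :=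
  CFC.sqrt_mul_sqrt_self _ (star_mul_self_nonneg _)

theorem invSqrtBracket_mul_self (hH : IsSelfAdjoint H) :
    invSqrtBracket hH * invSqrtBracket hH = invBracket hH :=
  CFC.sqrt_mul_sqrt_self _ (invBracket_nonneg hH)

theorem norm_apply_eq_of_star_mul_self {A C : 𝓗 →L[ℂ] 𝓗} (h : star A * A = star C * C) (v : 𝓗) :
    ‖A v‖ = ‖C v‖ := by
  have : ‖A v‖ ^ 2 = ‖C v‖ ^ 2 := by
    rw [ContinuousLinearMap.apply_norm_sq_eq_inner_adjoint_left,
      ContinuousLinearMap.apply_norm_sq_eq_inner_adjoint_left]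
    change RCLike.re ⟪(star A * A) v, v⟫_ℂ = RCLike.re ⟪(star C * C) v, v⟫_ℂ
    rw [h]
  exact (sq_eq_sq₀ (norm_nonneg _) (norm_nonneg _)).1 this

theorem norm_invBracket_apply (hH : IsSelfAdjoint H) (v : 𝓗) :
    ‖invBracket hH v‖ = ‖resolventI hH v‖ :=
  norm_apply_eq_of_star_mul_self (by rw [star_invBracket, invBracket_mul_self]) v

theorem norm_star_resolventI_apply (hH : IsSelfAdjoint H) (v : 𝓗) :
    ‖star (resolventI hH) v‖ = ‖invBracket hH v‖ :=
  norm_apply_eq_of_star_mul_self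
    (by rw [star_star, star_invBracket, invBracket_mul_self, resolventI_normal]) v

theorem resolventI_injective (hH : IsSelfAdjoint H) : Function.Injective (resolventI hH) := by
  intro x y hxy
  rw [← shift_resolventOp hH (z := Complex.I) (by simp) x,
    ← shift_resolventOp hH (z := Complex.I) (by simp) y]
  congr 2

theorem invBracket_injective (hH : IsSelfAdjoint H) : Function.Injective (invBracket hH) := by
  rw [injective_iff_map_eq_zero]
  intro v hv
  have := norm_invBracket_apply hH v
  rw [hv, norm_zero] at this
  exact (injective_iff_map_eq_zero (resolventI hH)).1 (resolventI_injective hH) v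
    (norm_eq_zero.1 this.symm)

theorem invSqrtBracket_injective (hH : IsSelfAdjoint H) :
    Function.Injective (invSqrtBracket hH) := by
  intro x y hxy
  apply invBracket_injective hH
  rw [← invSqrtBracket_mul_self]
  exact congrArg (invSqrtBracket hH) hxy

/-- `⟨H⟩⁻¹` maps onto the domain of `H`. -/
theorem mem_domain_iff (hH : IsSelfAdjoint H) (f : 𝓗) :
    f ∈ H.domain ↔ ∃ x, invBracket hH x = f := by
  constructor
  · intro hf
    obtain ⟨D, hD⟩ := exists_factor (A := resolventI hH) (invBracket_injective hH) 1
      (fun v => by rw [norm_star_resolventI_apply, star_invBracket, one_mul])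
    refine ⟨D (shift H Complex.I ⟨f, hf⟩), ?_⟩
    change (invBracket hH * D) _ = _
    rw [← hD]
    exact resolventOp_shift hH (z := Complex.I) (by simp) ⟨f, hf⟩
  · rintro ⟨x, rfl⟩
    obtain ⟨D, hD⟩ := exists_factor (A := invBracket hH) (resolventI_injective hH) 1
      (fun v => by rw [norm_star_resolventI_apply, star_invBracket, one_mul])
    rw [hD]
    exact resolventOp_mem hH _ _

/-- The form domain of the self-adjoint operator `H`: the domain of `|H|^(1/2)`, that is, the
domain of `⟨H⟩^(1/2) = (1 + H²)^(1/4)`, which is the range of `⟨H⟩^(-1/2)`. -/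
def FormDomain (hH : IsSelfAdjoint H) : Type _ := LinearMap.range (invSqrtBracket hH).toLinearMap

instance (hH : IsSelfAdjoint H) : AddCommGroup (FormDomain hH) :=
  inferInstanceAs (AddCommGroup (LinearMap.range (invSqrtBracket hH).toLinearMap))

instance (hH : IsSelfAdjoint H) : Module ℂ (FormDomain hH) :=
  inferInstanceAs (Module ℂ (LinearMap.range (invSqrtBracket hH).toLinearMap))

/-- The operator `⟨H⟩^(1/2)` from the form domain onto the Hilbert space. -/
def sqrtBracket (hH : IsSelfAdjoint H) : FormDomain hH ≃ₗ[ℂ] 𝓗 :=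
  (LinearEquiv.ofInjective (invSqrtBracket hH).toLinearMap (invSqrtBracket_injective hH)).symm

/-- The norm `‖⟨H⟩^(1/2) f‖` on the form domain; it is equivalent to the graph norm
`(‖f‖² + ‖|H|^(1/2) f‖²)^(1/2)`. -/
instance (hH : IsSelfAdjoint H) : NormedAddCommGroup (FormDomain hH) :=
  NormedAddCommGroup.induced (FormDomain hH) 𝓗 (sqrtBracket hH) (sqrtBracket hH).injective

instance (hH : IsSelfAdjoint H) : NormedSpace ℂ (FormDomain hH) :=
  NormedSpace.induced ℂ (FormDomain hH) 𝓗 (sqrtBracket hH).toLinearMap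

/-- `⟨H⟩^(1/2)` as an isometric isomorphism. -/
def sqrtBracketₗᵢ (hH : IsSelfAdjoint H) : FormDomain hH ≃ₗᵢ[ℂ] 𝓗 where
  toLinearEquiv := sqrtBracket hH
  norm_map' _ := rfl

/-- The inclusion of the form domain in the Hilbert space. -/
def FormDomain.val (hH : IsSelfAdjoint H) : FormDomain hH →ₗ[ℂ] 𝓗 :=
  Submodule.subtype (LinearMap.range (invSqrtBracket hH).toLinearMap)

theorem FormDomain.val_eq (hH : IsSelfAdjoint H) (f : FormDomain hH) :
    FormDomain.val hH f = invSqrtBracket hH (sqrtBracketₗᵢ hH f) :=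
  (congrArg Subtype.val ((LinearEquiv.ofInjective (invSqrtBracket hH).toLinearMap
    (invSqrtBracket_injective hH)).apply_symm_apply f)).symm

theorem FormDomain.val_symm (hH : IsSelfAdjoint H) (x : 𝓗) :
    FormDomain.val hH ((sqrtBracketₗᵢ hH).symm x) = invSqrtBracket hH x := by
  rw [FormDomain.val_eq, LinearIsometryEquiv.apply_symm_apply]

end FormDomain

section Extensions

set_option linter.unusedSectionVars false

variable {𝓗 : Type*} [NormedAddCommGroup 𝓗] [InnerProductSpace ℂ 𝓗] [CompleteSpace 𝓗]
variable {H : 𝓗 →ₗ.[ℂ] 𝓗}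

/-- The topological anti-dual: continuous antilinear functionals, with the dual norm. -/
abbrev AntiDual (E : Type*) [NormedAddCommGroup E] [NormedSpace ℂ E] : Type _ := E →L⋆[ℂ] ℂ

theorem exists_factor_of_range {A C : 𝓗 →L[ℂ] 𝓗} (hC : Function.Injective C)
    (h : ∀ x, ∃ y, C y = A x) : ∃ D : 𝓗 →L[ℂ] 𝓗, A = C * D := by
  choose D hD using h
  let D' : 𝓗 →ₗ[ℂ] 𝓗 :=
    { toFun := D
      map_add' := fun x y => hC (by rw [map_add, hD, hD, hD, map_add])
      map_smul' := fun c x => hC (by rw [map_smul, hD, hD, map_smul]; rfl) }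
  refine ⟨ContinuousLinearMap.ofSeqClosedGraph (g := D') ?_, ?_⟩
  · intro u x y hu hy
    apply hC
    have h1 : Tendsto (fun n => C (D' (u n))) atTop (𝓝 (C y)) := (C.continuous.tendsto y).comp hy
    have h2 : Tendsto (fun n => C (D' (u n))) atTop (𝓝 (A x)) := by
      have : (fun n => C (D' (u n))) = fun n => A (u n) := funext fun n => hD (u n)
      rw [this]
      exact (A.continuous.tendsto x).comp hu
    rw [tendsto_nhds_unique h1 h2]
    exact (hD x).symm
  · ext x; exact (hD x).symm

/-- Square roots preserve the operator order. -/
theorem le_smul_of_sq_eq {P J X : 𝓗 →L[ℂ] 𝓗} (hP : 0 ≤ P) (hJ : 0 ≤ J)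
    (h : P * P = J * (X * star X) * J) : P ≤ ‖X‖ • J := by
  have hJs : star J = J := (IsSelfAdjoint.of_nonneg hJ).star_eq
  have h1 : P * P ≤ (‖X‖ • J) * (‖X‖ • J) := by
    have h2 := star_left_conjugate_le_conjugate (CStarAlgebra.mul_star_le_algebraMap_norm_sq (a := X)) J
    rw [hJs, ← h] at h2
    refine h2.trans_eq ?_
    rw [Algebra.algebraMap_eq_smul_one, mul_smul_comm, mul_one, smul_mul_assoc, smul_mul_smul_comm,
      sq]
  have hk : 0 ≤ ‖X‖ • J := smul_nonneg (norm_nonneg _) hJ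
  have h3 := CFC.sqrt_le_sqrt _ _ h1
  rwa [CFC.sqrt_mul_self P hP, CFC.sqrt_mul_self _ hk] at h3

theorem norm_sqrt_apply_le {P B : 𝓗 →L[ℂ] 𝓗} (hP : 0 ≤ P) (hB : 0 ≤ B) {k : ℝ} (hk : 0 ≤ k)
    (h : P ≤ k • (B * B)) (v : 𝓗) : ‖CFC.sqrt P v‖ ≤ √k * ‖B v‖ := by
  have h1 : ∀ Q : 𝓗 →L[ℂ] 𝓗, 0 ≤ Q → ‖Q v‖ ^ 2 = RCLike.re ⟪(Q * Q) v, v⟫_ℂ := by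
    intro Q hQ
    rw [ContinuousLinearMap.apply_norm_sq_eq_inner_adjoint_left, ← ContinuousLinearMap.star_eq_adjoint,
      (IsSelfAdjoint.of_nonneg hQ).star_eq]
    rfl
  have h2 : ‖CFC.sqrt P v‖ ^ 2 ≤ (√k * ‖B v‖) ^ 2 := by
    rw [h1 _ (CFC.sqrt_nonneg P), CFC.sqrt_mul_sqrt_self P hP, mul_pow, Real.sq_sqrt hk, h1 B hB]
    have h3 := ((ContinuousLinearMap.le_def _ _).1 h).re_inner_nonneg_left v
    rw [sub_apply, inner_sub_left, map_sub, smul_apply,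
      inner_smul_left_eq_smul, RCLike.smul_re] at h3
    linarith
  exact (sq_le_sq₀ (norm_nonneg _) (by positivity)).1 h2

/-- A bounded self-adjoint `M = ⟨H⟩⁻¹ X` is `⟨H⟩^(-1/2) N ⟨H⟩^(-1/2)` for a bounded `N`. -/
theorem exists_middle_factor (hH : IsSelfAdjoint H) (X : 𝓗 →L[ℂ] 𝓗)
    (hM : IsSelfAdjoint (invBracket hH * X)) :
    ∃ N : 𝓗 →L[ℂ] 𝓗, invBracket hH * X = invSqrtBracket hH * N * invSqrtBracket hH := by
  set J := invBracket hH with hJ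
  set B := invSqrtBracket hH with hB
  set M := J * X with hMdef
  have hJ0 : 0 ≤ J := invBracket_nonneg hH
  have hB0 : 0 ≤ B := invSqrtBracket_nonneg hH
  have hBs : star B = B := star_invSqrtBracket hH
  have hBB : B * B = J := invSqrtBracket_mul_self hH
  have habs : CFC.abs M ≤ ‖X‖ • J := by
    refine le_smul_of_sq_eq (CFC.abs_nonneg M) hJ0 ?_
    rw [CFC.abs_mul_abs, hM.star_eq]
    conv_lhs => rw [← hM.star_eq]
    conv_lhs => rw [hM.star_eq]; enter [2]; rw [← hM.star_eq]
    rw [hMdef, star_mul, star_invBracket]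
    simp only [mul_assoc]
    rfl
  have h1 : 0 ≤ CFC.abs M + M := by
    rw [CFC.abs_add_self M hM]; exact nsmul_nonneg (CFC.posPart_nonneg M) 2
  have h2 : 0 ≤ CFC.abs M - M := by
    rw [CFC.abs_sub_self M hM]; exact nsmul_nonneg (CFC.negPart_nonneg M) 2
  have hP0 : 0 ≤ M + ‖X‖ • J := by
    have := add_nonneg h1 (sub_nonneg.2 habs)
    convert this using 1; abel
  have hP1 : M + ‖X‖ • J ≤ (2 * ‖X‖) • (B * B) := by
    have := add_nonneg h2 (sub_nonneg.2 habs)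
    rw [← sub_nonneg]
    convert this using 1
    rw [hBB, two_mul, add_smul]; abel
  have hQ := norm_sqrt_apply_le hP0 hB0 (by positivity) hP1
  have hQs : star (CFC.sqrt (M + ‖X‖ • J)) = CFC.sqrt (M + ‖X‖ • J) :=
    (IsSelfAdjoint.of_nonneg (CFC.sqrt_nonneg _)).star_eq
  obtain ⟨D, hD⟩ := exists_factor (A := CFC.sqrt (M + ‖X‖ • J)) (invSqrtBracket_injective hH) _
    (fun v => by rw [hQs, star_invSqrtBracket]; exact hQ v)
  have hfac : M + ‖X‖ • J = B * (D * star D) * B := by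
    rw [← CFC.sqrt_mul_sqrt_self _ hP0]
    conv_lhs => enter [2]; rw [← hQs]
    rw [hD, star_mul, star_invSqrtBracket]
    simp only [mul_assoc]
    rfl
  refine ⟨D * star D - ‖X‖ • 1, ?_⟩
  rw [mul_sub, sub_mul, ← hfac, mul_smul_comm, mul_one, smul_mul_assoc, hBB]
  abel

/-- The inclusion of the operator domain in the form domain. -/
def domainToForm (hH : IsSelfAdjoint H) : H.domain →ₗ[ℂ] FormDomain hH :=
  LinearMap.codRestrict (LinearMap.range (invSqrtBracket hH).toLinearMap) H.domain.subtype
    (fun f => by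
      obtain ⟨x, hx⟩ := (mem_domain_iff hH (f : 𝓗)).1 f.2
      refine ⟨invSqrtBracket hH x, ?_⟩
      rw [← invSqrtBracket_mul_self] at hx
      exact hx)

theorem val_domainToForm (hH : IsSelfAdjoint H) (f : H.domain) :
    FormDomain.val hH (domainToForm hH f) = f := rfl

/-- A symmetric operator `T` defined on the domain of `H` has a continuous extension from the form
domain to its anti-dual. -/
theorem exists_formExt (hH : IsSelfAdjoint H) (T : H.domain →ₗ[ℂ] 𝓗)
    (hT : ∀ f g : H.domain, ⟪T f, (g : 𝓗)⟫_ℂ = ⟪(f : 𝓗), T g⟫_ℂ) :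
    ∃ K : FormDomain hH →L[ℂ] AntiDual (FormDomain hH), ∀ (f : FormDomain hH) (g : H.domain),
      K (domainToForm hH g) f = ⟪FormDomain.val hH f, T g⟫_ℂ := by
  have hmem : ∀ x, invBracket hH x ∈ H.domain := fun x => (mem_domain_iff hH _).2 ⟨x, rfl⟩
  let Jd : 𝓗 →ₗ[ℂ] H.domain := LinearMap.codRestrict H.domain (invBracket hH).toLinearMap hmem
  have hJd : ∀ x, (Jd x : 𝓗) = invBracket hH x := fun x => rfl
  let X : 𝓗 →L[ℂ] 𝓗 := ContinuousLinearMap.ofSeqClosedGraph (g := T ∘ₗ Jd) (by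
    intro u x y hu hy
    refine hH.dense_domain.eq_of_inner_right ℂ fun h hh => ?_
    have e : ∀ z, ⟪h, (T ∘ₗ Jd) z⟫_ℂ = ⟪T ⟨h, hh⟩, invBracket hH z⟫_ℂ := fun z =>
      (hT ⟨h, hh⟩ (Jd z)).symm
    have h1 : Tendsto (fun n => ⟪h, (T ∘ₗ Jd) (u n)⟫_ℂ) atTop (𝓝 ⟪h, y⟫_ℂ) :=
      tendsto_const_nhds.inner hy
    have h2 : Tendsto (fun n => ⟪h, (T ∘ₗ Jd) (u n)⟫_ℂ) atTop (𝓝 ⟪h, (T ∘ₗ Jd) x⟫_ℂ) := by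
      simp only [e]
      exact tendsto_const_nhds.inner (((invBracket hH).continuous.tendsto x).comp hu)
    exact tendsto_nhds_unique h1 h2)
  have hX : ∀ x, X x = T (Jd x) := fun x => rfl
  have hJs : ∀ x y, ⟪invBracket hH x, y⟫_ℂ = ⟪x, invBracket hH y⟫_ℂ := fun x y => by
    conv_lhs => rw [← star_invBracket, ContinuousLinearMap.star_eq_adjoint,
      ContinuousLinearMap.adjoint_inner_left]
  have hBs : ∀ x y, ⟪invSqrtBracket hH x, y⟫_ℂ = ⟪x, invSqrtBracket hH y⟫_ℂ := fun x y => by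
    conv_lhs => rw [← star_invSqrtBracket, ContinuousLinearMap.star_eq_adjoint,
      ContinuousLinearMap.adjoint_inner_left]
  have hM : IsSelfAdjoint (invBracket hH * X) := by
    rw [ContinuousLinearMap.isSelfAdjoint_iff_isSymmetric]
    intro x y
    change ⟪invBracket hH (X x), y⟫_ℂ = ⟪x, invBracket hH (X y)⟫_ℂ
    rw [hJs, ← hJs x, hX, hX, ← hJd, ← hJd, hT]
  obtain ⟨N, hN⟩ := exists_middle_factor hH X hM
  have hNB : ∀ x, N (invSqrtBracket hH x) = invSqrtBracket hH (X x) := by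
    intro x
    apply invSqrtBracket_injective hH
    have : (invBracket hH * X) x = (invSqrtBracket hH * N * invSqrtBracket hH) x := by rw [hN]
    rw [← invSqrtBracket_mul_self] at this
    exact this.symm
  let e : FormDomain hH →L[ℂ] 𝓗 := (sqrtBracketₗᵢ hH).toContinuousLinearEquiv.toContinuousLinearMap
  refine ⟨(innerSL ℂ).flip.bilinearComp (N ∘L e) e, fun f g => ?_⟩
  change ⟪sqrtBracketₗᵢ hH f, N (sqrtBracketₗᵢ hH (domainToForm hH g))⟫_ℂ = _
  obtain ⟨x, hx⟩ := (mem_domain_iff hH (g : 𝓗)).1 g.2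
  have hg : sqrtBracketₗᵢ hH (domainToForm hH g) = invSqrtBracket hH x := by
    apply invSqrtBracket_injective hH
    rw [← FormDomain.val_eq, val_domainToForm, ← hx, ← invSqrtBracket_mul_self]
    rfl
  have hg' : Jd x = g := Subtype.ext hx
  rw [hg, hNB, ← hBs, ← FormDomain.val_eq, hX, hg']

/-- The continuous extension, from the form domain to its anti-dual, of a symmetric operator `T`
defined on the domain of `H`; it is unique because the domain of `H` is dense in the form domain. -/
def formExt (hH : IsSelfAdjoint H) (T : H.domain →ₗ[ℂ] 𝓗)
    (hT : ∀ f g : H.domain, ⟪T f, (g : 𝓗)⟫_ℂ = ⟪(f : 𝓗), T g⟫_ℂ) :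
    FormDomain hH →L[ℂ] AntiDual (FormDomain hH) :=
  (exists_formExt hH T hT).choose

theorem formExt_apply (hH : IsSelfAdjoint H) (T : H.domain →ₗ[ℂ] 𝓗)
    (hT : ∀ f g : H.domain, ⟪T f, (g : 𝓗)⟫_ℂ = ⟪(f : 𝓗), T g⟫_ℂ)
    (f : FormDomain hH) (g : H.domain) :
    formExt hH T hT (domainToForm hH g) f = ⟪FormDomain.val hH f, T g⟫_ℂ :=
  (exists_formExt hH T hT).choose_spec f g

/-- The embedding of the Hilbert space in the anti-dual of the form domain: `g` is identified with
the antilinear functional `f ↦ ⟨f, g⟩`. -/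
def toAntiDual (hH : IsSelfAdjoint H) : 𝓗 →L[ℂ] AntiDual (FormDomain hH) :=
  (innerSL ℂ).flip.bilinearComp (ContinuousLinearMap.id ℂ 𝓗)
    (invSqrtBracket hH ∘L (sqrtBracketₗᵢ hH).toContinuousLinearEquiv.toContinuousLinearMap)

theorem toAntiDual_apply (hH : IsSelfAdjoint H) (g : 𝓗) (f : FormDomain hH) :
    toAntiDual hH g f = ⟪FormDomain.val hH f, g⟫_ℂ := by
  rw [FormDomain.val_eq]; rfl

theorem exists_rieszVec : ∃ r : AntiDual 𝓗 →L[ℂ] 𝓗, ∀ φ x, ⟪x, r φ⟫_ℂ = φ x := by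
  let r : AntiDual 𝓗 → 𝓗 := fun φ => (InnerProductSpace.toDual ℂ 𝓗).symm
    ((starL ℂ : ℂ ≃L⋆[ℂ] ℂ).toContinuousLinearMap.comp φ)
  have hr : ∀ φ x, ⟪x, r φ⟫_ℂ = φ x := fun φ x => by
    rw [← inner_conj_symm, InnerProductSpace.toDual_symm_apply]
    simp
  let r' : AntiDual 𝓗 →ₗ[ℂ] 𝓗 :=
    { toFun := r
      map_add' := fun φ ψ => ext_inner_left ℂ fun v => by
        rw [inner_add_right, hr, hr, hr]; rfl
      map_smul' := fun c φ => ext_inner_left ℂ fun v => by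
        rw [inner_smul_right, hr, hr]; rfl }
  refine ⟨LinearMap.mkContinuous r' 1 fun φ => ?_, hr⟩
  have h1 : ‖r φ‖ * ‖r φ‖ ≤ ‖φ‖ * ‖r φ‖ := by
    have h2 : ‖⟪r φ, r φ⟫_ℂ‖ ≤ ‖φ‖ * ‖r φ‖ := by
      rw [hr]; exact φ.le_opNorm _
    rwa [inner_self_eq_norm_sq_to_K, norm_pow, RCLike.norm_ofReal, abs_norm, sq] at h2
  rw [one_mul]
  rcases (norm_nonneg (r φ)).eq_or_lt with h | h
  · exact h.symm.trans_le (norm_nonneg φ)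
  · exact le_of_mul_le_mul_right h1 h

theorem exists_resolventExt (hH : IsSelfAdjoint H) (z : ℂ) (hz : z.im ≠ 0) :
    ∃ Q : AntiDual (FormDomain hH) →L[ℂ] FormDomain hH, ∀ x : 𝓗,
      FormDomain.val hH (Q (toAntiDual hH x)) = resolventOp hH z hz x := by
  obtain ⟨rieszVec, inner_rieszVec⟩ := exists_rieszVec (𝓗 := 𝓗)
  obtain ⟨U, hU⟩ := exists_factor_of_range (A := resolventOp hH z hz) (invBracket_injective hH)
    (fun x => (mem_domain_iff hH _).1 (resolventOp_mem hH hz x))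
  have hc : Commute (resolventOp hH z hz) (invSqrtBracket hH) := by
    have h1 : Commute (resolventOp hH z hz) (star (resolventI hH) * resolventI hH) := by
      refine Commute.mul_right ?_ (resolventOp_commute hH hz _)
      rw [ContinuousLinearMap.star_eq_adjoint, resolventI, resolventOp_adjoint]
      exact resolventOp_commute hH hz _
    exact ((h1.symm.cfcₙ_nnreal _).cfcₙ_nnreal _).symm
  have hUB : ∀ x, U (invSqrtBracket hH x) = invSqrtBracket hH (U x) := by
    intro x
    apply invBracket_injective hH
    have e1 : invBracket hH (U (invSqrtBracket hH x)) = (resolventOp hH z hz) (invSqrtBracket hH x) := by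
      rw [hU]; rfl
    have e2 : (resolventOp hH z hz) (invSqrtBracket hH x) = invSqrtBracket hH (resolventOp hH z hz x) :=
      congrArg (fun L : 𝓗 →L[ℂ] 𝓗 => L x) hc.eq
    have e3 : invSqrtBracket hH (resolventOp hH z hz x) = invSqrtBracket hH (invBracket hH (U x)) := by
      conv_lhs => rw [hU]
      rfl
    rw [e1, e2, e3, ← invSqrtBracket_mul_self]
    rfl
  let e : 𝓗 →L[ℂ] FormDomain hH :=
    (sqrtBracketₗᵢ hH).symm.toContinuousLinearEquiv.toContinuousLinearMap
  refine ⟨e ∘L U ∘L rieszVec ∘L (ContinuousLinearMap.precomp ℂ e), fun x => ?_⟩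
  have h : rieszVec ((toAntiDual hH x).comp e) = invSqrtBracket hH x := by
    refine ext_inner_left ℂ fun v => ?_
    rw [inner_rieszVec]
    change toAntiDual hH x ((sqrtBracketₗᵢ hH).symm v) = _
    rw [toAntiDual_apply, FormDomain.val_symm]
    conv_lhs => rw [← star_invSqrtBracket, ContinuousLinearMap.star_eq_adjoint,
      ContinuousLinearMap.adjoint_inner_left]
  change FormDomain.val hH ((sqrtBracketₗᵢ hH).symm (U (rieszVec ((toAntiDual hH x).comp e)))) = _
  rw [FormDomain.val_symm, h, hUB, hU, ← invSqrtBracket_mul_self]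
  rfl

/-- The continuous extension of the resolvent `(H - z)⁻¹` from the anti-dual of the form domain to
the form domain; it is unique because the Hilbert space is dense in that anti-dual. -/
def resolventExt (hH : IsSelfAdjoint H) (z : ℂ) (hz : z.im ≠ 0) :
    AntiDual (FormDomain hH) →L[ℂ] FormDomain hH :=
  (exists_resolventExt hH z hz).choose

theorem resolventExt_apply (hH : IsSelfAdjoint H) (z : ℂ) (hz : z.im ≠ 0) (x : 𝓗) :
    FormDomain.val hH (resolventExt hH z hz (toAntiDual hH x)) = resolventOp hH z hz x :=
  (exists_resolventExt hH z hz).choose_spec x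

end Extensions

section Groups

/-- A `C₀`-group of bounded operators on a Banach space. -/
structure C0Group (X : Type*) [NormedAddCommGroup X] [NormedSpace ℂ X] where
  /-- The operators of the group. -/
  toFun : ℝ → X →L[ℂ] X
  map_zero : toFun 0 = ContinuousLinearMap.id ℂ X
  map_add : ∀ s t, toFun (s + t) = (toFun s).comp (toFun t)
  continuous_orbit : ∀ x, Continuous fun t => toFun t x

instance (X : Type*) [NormedAddCommGroup X] [NormedSpace ℂ X] :
    CoeFun (C0Group X) fun _ => ℝ → X →L[ℂ] X := ⟨C0Group.toFun⟩

variable {X Y : Type*} [NormedAddCommGroup X] [NormedSpace ℂ X]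
  [NormedAddCommGroup Y] [NormedSpace ℂ Y]

/-- The generator `A` of a one-parameter family `U t = exp (i t A)`: its domain consists of the
vectors whose orbit is differentiable in norm at `0`, and `A x = -i (d/dt) U t x` at `t = 0`. -/
def generator (U : ℝ → X →L[ℂ] X) : X →ₗ.[ℂ] X where
  domain :=
    { carrier := {x | DifferentiableAt ℝ (fun t => U t x) 0}
      add_mem' := fun {x y} hx hy => by
        have hx' : DifferentiableAt ℝ (fun t => U t x) 0 := hx
        have hy' : DifferentiableAt ℝ (fun t => U t y) 0 := hy
        change DifferentiableAt ℝ (fun t => U t (x + y)) 0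
        simp only [map_add]
        exact hx'.add hy'
      zero_mem' := by
        change DifferentiableAt ℝ (fun t => U t 0) 0
        simp only [map_zero]
        exact differentiableAt_const _
      smul_mem' := fun c x hx => by
        have hx' : DifferentiableAt ℝ (fun t => U t x) 0 := hx
        change DifferentiableAt ℝ (fun t => U t (c • x)) 0
        simp only [map_smul]
        exact hx'.const_smul c }
  toFun :=
    { toFun := fun x => (-Complex.I) • deriv (fun t => U t (x : X)) 0
      map_add' := fun x y => by
        have hx : DifferentiableAt ℝ (fun t => U t (x : X)) 0 := x.2
        have hy : DifferentiableAt ℝ (fun t => U t (y : X)) 0 := y.2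
        rw [← smul_add, ← deriv_fun_add hx hy]
        simp only [Submodule.coe_add, map_add]
      map_smul' := fun c x => by
        have hx : DifferentiableAt ℝ (fun t => U t (x : X)) 0 := x.2
        rw [RingHom.id_apply, smul_comm c, ← deriv_fun_const_smul c hx]
        simp only [Submodule.coe_smul, map_smul] }

/-- The class `C¹(A; X, Y)`, where `U` and `V` are the groups generated by `A` in `X` and `Y`:
the map `t ↦ V (-t) T (U t)` is strongly differentiable. -/
def IsC1 (U : ℝ → X →L[ℂ] X) (V : ℝ → Y →L[ℂ] Y) (T : X →L[ℂ] Y) : Prop :=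
  ∀ x, Differentiable ℝ fun t => V (-t) (T (U t x))

/-- The group induced in the anti-dual: `(U t φ) x = φ (U (-t) x)`. -/
def dualGroup (U : ℝ → X →L[ℂ] X) (t : ℝ) : AntiDual X →L[ℂ] AntiDual X :=
  ContinuousLinearMap.precomp ℂ (U (-t))

/-- The `K`-functional of the couple formed by the Banach space `Y` and the domain of the operator
`A` in `Y`, the latter with the graph norm `‖g‖ + ‖A g‖`. -/
def kFunctional (A : Y →ₗ.[ℂ] Y) (t : ℝ) (f : Y) : ENNReal :=
  ⨅ g : A.domain, ‖f - (g : Y)‖ₑ + ENNReal.ofReal t * (‖(g : Y)‖ₑ + ‖A g‖ₑ)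

/-- The norm of the real interpolation space `(D(A), Y)_{1/2,1}`, namely
`∫₀^∞ t^(-1/2) K(t, f) dt/t`. It is infinite outside of that space. -/
def interpNorm (A : Y →ₗ.[ℂ] Y) (f : Y) : ENNReal :=
  ∫⁻ t in Set.Ioi (0 : ℝ), ENNReal.ofReal (t ^ (-(3 / 2) : ℝ)) * kFunctional A t f

end Groups

section Commutator

set_option linter.unusedSectionVars false

variable {𝓗 : Type*} [NormedAddCommGroup 𝓗] [InnerProductSpace ℂ 𝓗] [CompleteSpace 𝓗]
variable {H : 𝓗 →ₗ.[ℂ] 𝓗} {W : C0Group 𝓗}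

/-- The operator `W (-t) H (W t)` on the domain of `H`, when `W` leaves that domain invariant. -/
def conjugated (hinv : ∀ t, ∀ f ∈ H.domain, W t f ∈ H.domain) (t : ℝ) : H.domain →ₗ[ℂ] 𝓗 :=
  (W (-t)).toLinearMap ∘ₗ H.toFun ∘ₗ
    LinearMap.codRestrict H.domain ((W t).toLinearMap ∘ₗ H.domain.subtype) (fun f => hinv t f f.2)

theorem conjugated_apply (hinv : ∀ t, ∀ f ∈ H.domain, W t f ∈ H.domain) (t : ℝ) (f : H.domain) :
    conjugated hinv t f = W (-t) (H ⟨W t f, hinv t f f.2⟩) := rfl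

/-- `H` belongs to `C¹(A; D(H), 𝓗)`: the map `t ↦ W (-t) H (W t)` is strongly differentiable. -/
def DomainIsC1 (hinv : ∀ t, ∀ f ∈ H.domain, W t f ∈ H.domain) : Prop :=
  ∀ f : H.domain, Differentiable ℝ fun t => conjugated hinv t f

/-- The commutator `[iH, A]` on the domain of `H`: the strong derivative of `W (-t) H (W t)`
at `t = 0`. -/
def commutator (hinv : ∀ t, ∀ f ∈ H.domain, W t f ∈ H.domain) (hC1 : DomainIsC1 hinv) :
    H.domain →ₗ[ℂ] 𝓗 where
  toFun f := deriv (fun t => conjugated hinv t f) 0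
  map_add' f g := by
    simp only [map_add]
    exact deriv_fun_add (hC1 f 0) (hC1 g 0)
  map_smul' c f := by
    simp only [map_smul]
    exact deriv_fun_const_smul c (hC1 f 0)

theorem inner_group (hW : ∀ t, W t ∈ unitary (𝓗 →L[ℂ] 𝓗)) (t : ℝ) (x y : 𝓗) :
    ⟪W t x, y⟫_ℂ = ⟪x, W (-t) y⟫_ℂ := by
  have h1 : (W t).comp (W (-t)) = ContinuousLinearMap.id ℂ 𝓗 := by
    rw [← W.map_add, add_neg_cancel, W.map_zero]
  have h2 : star (W t) = W (-t) := by
    calc star (W t) = star (W t) * (W t * W (-t)) := by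
          have : W t * W (-t) = 1 := h1
          rw [this, mul_one]
      _ = W (-t) := by rw [← mul_assoc, Unitary.star_mul_self_of_mem (hW t), one_mul]
  rw [← h2, ContinuousLinearMap.star_eq_adjoint, ContinuousLinearMap.adjoint_inner_right]

theorem commutator_symm (hH : IsSelfAdjoint H) (hW : ∀ t, W t ∈ unitary (𝓗 →L[ℂ] 𝓗))
    (hinv : ∀ t, ∀ f ∈ H.domain, W t f ∈ H.domain) (hC1 : DomainIsC1 hinv) (f g : H.domain) :
    ⟪commutator hinv hC1 f, (g : 𝓗)⟫_ℂ = ⟪(f : 𝓗), commutator hinv hC1 g⟫_ℂ := by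
  have hf : HasDerivAt (fun t => conjugated hinv t f) (commutator hinv hC1 f) 0 :=
    (hC1 f 0).hasDerivAt
  have hg : HasDerivAt (fun t => conjugated hinv t g) (commutator hinv hC1 g) 0 :=
    (hC1 g 0).hasDerivAt
  have h1 := hf.inner ℂ (hasDerivAt_const (0 : ℝ) (g : 𝓗))
  have h2 := (hasDerivAt_const (0 : ℝ) (f : 𝓗)).inner ℂ hg
  have h3 : (fun t => ⟪conjugated hinv t f, (g : 𝓗)⟫_ℂ) =
      fun t => ⟪(f : 𝓗), conjugated hinv t g⟫_ℂ := by
    funext t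
    rw [conjugated_apply, conjugated_apply, ← inner_group hW, inner_group hW, neg_neg]
    exact symm_of_isSelfAdjoint hH ⟨W t f, hinv t f f.2⟩ ⟨W t g, hinv t g g.2⟩
  rw [h3] at h1
  simpa using h1.unique h2

/-- The form domain is invariant under a unitary group that leaves the operator domain
invariant. -/
theorem exists_group_mem (hH : IsSelfAdjoint H) (hW : ∀ t, W t ∈ unitary (𝓗 →L[ℂ] 𝓗))
    (hinv : ∀ t, ∀ f ∈ H.domain, W t f ∈ H.domain) (t : ℝ) (f : FormDomain hH) :
    ∃ x, invSqrtBracket hH x = W t (FormDomain.val hH f) := by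
  set J := invBracket hH
  set B := invSqrtBracket hH
  have hJ0 : 0 ≤ J := invBracket_nonneg hH
  obtain ⟨Z, hZ⟩ := exists_factor_of_range (A := W t * J) (invBracket_injective hH)
    (fun x => (mem_domain_iff hH _).1 (hinv t _ ((mem_domain_iff hH _).2 ⟨x, rfl⟩)))
  have hY : star (W t) * W t = 1 := Unitary.star_mul_self_of_mem (hW t)
  have hle : W t * J * star (W t) ≤ ‖Z‖ • J := by
    refine le_smul_of_sq_eq (star_right_conjugate_nonneg hJ0 (W t)) hJ0 ?_
    calc W t * J * star (W t) * (W t * J * star (W t))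
        = W t * J * (star (W t) * W t) * (J * star (W t)) := by simp only [mul_assoc]
      _ = (W t * J) * star (W t * J) := by rw [hY, mul_one, star_mul, star_invBracket]
      _ = J * (Z * star Z) * J := by rw [hZ, star_mul, star_invBracket]; simp only [mul_assoc]; rfl
  have hBs : star B = B := star_invSqrtBracket hH
  obtain ⟨D, hD⟩ := exists_factor (A := W t * B) (invSqrtBracket_injective hH) (√‖Z‖) (fun v => by
    have h1 := norm_sqrt_apply_le (star_right_conjugate_nonneg hJ0 (W t))
      (invSqrtBracket_nonneg hH) (norm_nonneg Z) (by rw [invSqrtBracket_mul_self]; exact hle) v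
    rw [star_mul, star_invSqrtBracket]
    refine le_of_eq_of_le (norm_apply_eq_of_star_mul_self ?_ v) h1
    rw [star_mul, star_star, hBs, (IsSelfAdjoint.of_nonneg
      (CFC.sqrt_nonneg (W t * J * star (W t)))).star_eq,
      CFC.sqrt_mul_sqrt_self _ (star_right_conjugate_nonneg hJ0 (W t))]
    change W t * B * (B * star (W t)) = W t * J * star (W t)
    have hBB : B * B = J := invSqrtBracket_mul_self hH
    rw [← hBB]
    simp only [mul_assoc])
  refine ⟨D (sqrtBracketₗᵢ hH f), ?_⟩
  rw [FormDomain.val_eq]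
  exact (congrArg (fun L : 𝓗 →L[ℂ] 𝓗 => L (sqrtBracketₗᵢ hH f)) hD).symm

/-- The action of the group on the form domain. -/
def formGroup (hH : IsSelfAdjoint H) (hW : ∀ t, W t ∈ unitary (𝓗 →L[ℂ] 𝓗))
    (hinv : ∀ t, ∀ f ∈ H.domain, W t f ∈ H.domain) (t : ℝ) (f : FormDomain hH) : FormDomain hH :=
  ⟨W t (FormDomain.val hH f), exists_group_mem hH hW hinv t f⟩

theorem val_formGroup (hH : IsSelfAdjoint H) (hW : ∀ t, W t ∈ unitary (𝓗 →L[ℂ] 𝓗))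
    (hinv : ∀ t, ∀ f ∈ H.domain, W t f ∈ H.domain) (t : ℝ) (f : FormDomain hH) :
    FormDomain.val hH (formGroup hH hW hinv t f) = W t (FormDomain.val hH f) := rfl

/-- The operator `H` as a bounded operator from the form domain to its anti-dual. -/
def formOp (hH : IsSelfAdjoint H) : FormDomain hH →L[ℂ] AntiDual (FormDomain hH) :=
  formExt hH H.toFun (symm_of_isSelfAdjoint hH)

theorem formOp_apply (hH : IsSelfAdjoint H) (f : FormDomain hH) (g : H.domain) :
    formOp hH (domainToForm hH g) f = ⟪FormDomain.val hH f, H g⟫_ℂ :=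
  formExt_apply hH H.toFun (symm_of_isSelfAdjoint hH) f g

/-- The commutator `[iH, A]` as a bounded operator from the form domain to its anti-dual. -/
def formCommutator (hH : IsSelfAdjoint H) (hW : ∀ t, W t ∈ unitary (𝓗 →L[ℂ] 𝓗))
    (hinv : ∀ t, ∀ f ∈ H.domain, W t f ∈ H.domain) (hC1 : DomainIsC1 hinv) :
    FormDomain hH →L[ℂ] AntiDual (FormDomain hH) :=
  formExt hH (commutator hinv hC1) (commutator_symm hH hW hinv hC1)

theorem formCommutator_apply (hH : IsSelfAdjoint H) (hW : ∀ t, W t ∈ unitary (𝓗 →L[ℂ] 𝓗))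
    (hinv : ∀ t, ∀ f ∈ H.domain, W t f ∈ H.domain) (hC1 : DomainIsC1 hinv)
    (f : FormDomain hH) (g : H.domain) :
    formCommutator hH hW hinv hC1 (domainToForm hH g) f =
      ⟪FormDomain.val hH f, commutator hinv hC1 g⟫_ℂ :=
  formExt_apply hH (commutator hinv hC1) (commutator_symm hH hW hinv hC1) f g

end Commutator

section EnergySpace

variable {E : Type*} [NormedAddCommGroup E] [NormedSpace ℂ E]

/-- Strict positivity `S > 0`: for all `f ≠ 0` the number `⟨f, S f⟩` is real and positive. -/
def FormPos (S : E →L[ℂ] AntiDual E) : Prop := ∀ f : E, f ≠ 0 → 0 < S f f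

theorem FormPos.conj_symm {S : E →L[ℂ] AntiDual E} (hS : FormPos S) (f g : E) :
    conj (S f g) = S g f := by
  have him : ∀ h : E, (S h h).im = 0 := fun h => by
    by_cases h0 : h = 0
    · simp [h0]
    · exact ((Complex.lt_def.1 (hS h h0)).2).symm
  have h1 := him (f + g)
  have h2 := him (f + Complex.I • g)
  simp only [map_add, add_apply, map_smul, smul_apply, map_smulₛₗ, smul_eq_mul, Complex.add_im,
    him f, him g, Complex.conj_I, Complex.add_re, Complex.mul_im, Complex.mul_re, Complex.neg_re,
    Complex.neg_im, Complex.I_re, Complex.I_im] at h1 h2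
  apply Complex.ext
  · simp only [Complex.conj_re]; linarith
  · simp only [Complex.conj_im]; linarith

/-- The space `E` equipped with the scalar product `⟨f, S g⟩`. -/
def PreEnergy (S : E →L[ℂ] AntiDual E) (_ : FormPos S) : Type _ := E

instance (S : E →L[ℂ] AntiDual E) (hS : FormPos S) : AddCommGroup (PreEnergy S hS) :=
  inferInstanceAs (AddCommGroup E)

instance (S : E →L[ℂ] AntiDual E) (hS : FormPos S) : Module ℂ (PreEnergy S hS) :=
  inferInstanceAs (Module ℂ E)

/-- The scalar product `⟨f, S g⟩`. -/
@[reducible] def energyCore (S : E →L[ℂ] AntiDual E) (hS : FormPos S) :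
    InnerProductSpace.Core ℂ (PreEnergy S hS) where
  inner f g := S (g : E) (f : E)
  conj_inner_symm f g := hS.conj_symm (E := E) f g
  re_inner_nonneg f := by
    change 0 ≤ (S (f : E) (f : E)).re
    by_cases h0 : (f : E) = 0
    · have h1 : ∀ g : E, g = 0 → S g g = 0 := fun g hg => by rw [hg, map_zero]
      rw [h1 f h0, Complex.zero_re]
    · exact (Complex.lt_def.1 (hS f h0)).1.le
  add_left f g h := map_add (S (h : E)) (f : E) (g : E)
  smul_left f g r := map_smulₛₗ (S (g : E)) r (f : E)
  definite f hf := by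
    by_contra h0
    exact (hS f h0).ne' hf

instance (S : E →L[ℂ] AntiDual E) (hS : FormPos S) : NormedAddCommGroup (PreEnergy S hS) :=
  (energyCore S hS).toNormedAddCommGroup

instance (S : E →L[ℂ] AntiDual E) (hS : FormPos S) : InnerProductSpace ℂ (PreEnergy S hS) :=
  InnerProductSpace.ofCore (energyCore S hS).toCore

/-- The completion of `E` with respect to the norm `⟨f, S f⟩^(1/2)`. -/
abbrev EnergySpace (S : E →L[ℂ] AntiDual E) (hS : FormPos S) : Type _ :=
  UniformSpace.Completion (PreEnergy S hS)

theorem norm_preEnergy_sq (S : E →L[ℂ] AntiDual E) (hS : FormPos S) (f : PreEnergy S hS) :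
    ‖f‖ ^ 2 = (S (f : E) (f : E)).re :=
  (inner_self_eq_norm_sq (𝕜 := ℂ) f).symm

/-- The continuous embedding of `E` in the completion. -/
def toEnergy (S : E →L[ℂ] AntiDual E) (hS : FormPos S) : E →L[ℂ] EnergySpace S hS :=
  (UniformSpace.Completion.toComplL (𝕜 := ℂ) (E := PreEnergy S hS)).comp
    (LinearMap.mkContinuous (LinearMap.id (R := ℂ) (M := E) : E →ₗ[ℂ] PreEnergy S hS) (√‖S‖) (by
      intro f
      refine (sq_le_sq₀ (norm_nonneg _) (by positivity)).1 ?_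
      rw [norm_preEnergy_sq, mul_pow, Real.sq_sqrt (norm_nonneg S), sq, ← mul_assoc]
      exact (Complex.re_le_norm _).trans (((S f).le_opNorm f).trans
        (mul_le_mul_of_nonneg_right (S.le_opNorm f) (norm_nonneg f)))))

theorem norm_toEnergy_sq (S : E →L[ℂ] AntiDual E) (hS : FormPos S) (f : E) :
    ‖toEnergy S hS f‖ ^ 2 = (S f f).re := by
  rw [← norm_preEnergy_sq S hS f]
  exact congrArg (· ^ 2) (UniformSpace.Completion.norm_coe (E := PreEnergy S hS) f)

/-- The embedding of the anti-dual of the completion in the anti-dual of `E`, by restriction. -/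
def restrictForm (S : E →L[ℂ] AntiDual E) (hS : FormPos S) :
    AntiDual (EnergySpace S hS) →L[ℂ] AntiDual E :=
  ContinuousLinearMap.precomp ℂ (toEnergy S hS)

/-- The duality `⟨φ, f⟩` between the anti-dual of `E` and `E`, antilinear in `φ`. -/
def pairing (φ : AntiDual E) (f : E) : ℂ := conj (φ f)

end EnergySpace

end ConjugateOperator

end

/-!
# The limiting absorption principle for a weakly conjugate operator

Write `B = [iH, A]`, so that `S = B - c₁H`, and let `𝓢` be the energy space of `S`, with anti-dual
`𝓢*`. The resolvent at `z = λ + iμ` is approached by `G_ε = (H - z - iεB)⁻¹`, where `ε` has the sign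
of `μ`, and the quadratic form `⟨f, G_ε f⟩` is followed from a fixed `ε₀` down to `ε = 0`.

*Coercivity.* Adding `εc₁` times the real part of the form of `H - z - iεB` to its imaginary part
turns `B` into `S`. Since `c₁λ ≥ 0`, this gives
`|μ| ‖u‖² + |ε| ‖u‖²_𝓢 ≤ (1 + |ε|c₁) |⟨u, (H - z - iεB) u⟩|` (`regOp_coercive`). As `B` is
`H`-bounded, the method of continuity in `ε` then makes `H - z - iεB` invertible on the domain of
`H` for `|ε| ≤ ε₀`, with `ε₀` independent of `z` (`regOp_bijective`). Moreover `G_ε` extends to a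
bounded operator from `𝓢*` to `𝓢` with `‖G_ε f‖²_𝓢 ≤ (2/|ε|) |⟨f, G_ε f⟩|`.

*Differential inequality.* One has `dG_ε/dε = i G_ε B G_ε`, and conjugation by the group gives
`G_ε B G_ε = i (A G_ε - G_ε A) + iε G_ε [iB, A] G_ε`. Together with coercivity this yields, for `h`
in the domain of `A` in `𝓢*` and `ψ(ε) = ⟨h, G_ε h⟩`,
`|ψ'(ε)| ≤ c ‖A h‖ ε^(-1/2) |ψ(ε)|^(1/2) + c |ψ(ε)|`
(`norm_form_commutator_le`, `norm_form_sub_le_of_mem_domain`). The commutator identity is derived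
with operators from `𝓢` to `𝓢*` only: there the increment of `W (-t) H (W t)`, which makes no sense
on `𝓢` term by term, is the integral of `W (-s) B (W s)`.

*Interpolation.* On the interval `[ε₀/2^(n+1), ε₀/2^n]` the form is evaluated at an `h = g n` almost
optimal for the `K`-functional of `f` at `ε₀/2^n`. The jumps from `g n` to `g (n+1)` and the drifts
along the intervals add up to at most `c ‖f‖_E` times the square root of the largest value of the
form, plus a small multiple of that value, which can be absorbed (`norm_form_dyadic_le`). The bound
for `⟨f, G_ε f⟩` along `ε = ε₀/2^n` is uniform in `n` and `z`, and for fixed `z` the limit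
`n → ∞` is elementary (`norm_pairing_resolventExt_le`).
-/

noncomputable section

open Complex Filter Topology MeasureTheory
open scoped InnerProductSpace ComplexOrder ComplexConjugate

namespace ConjugateOperator

/-! ### Conjugation by the group and the commutator estimate -/

section OneParameterFamilies

variable {X Y : Type*} [NormedAddCommGroup X] [NormedSpace ℂ X]
  [NormedAddCommGroup Y] [NormedSpace ℂ Y]

theorem dualGroup_apply (U : ℝ → X →L[ℂ] X) (t : ℝ) (φ : AntiDual X) (x : X) :
    dualGroup U t φ x = φ (U (-t) x) := rfl

theorem C0Group.neg_apply_apply (V : C0Group X) (t : ℝ) (x : X) : V (-t) (V t x) = x := by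
  have h := V.map_add (-t) t
  rw [neg_add_cancel, V.map_zero] at h
  exact (congrArg (fun L : X →L[ℂ] X => L x) h).symm

theorem C0Group.apply_neg_apply (V : C0Group X) (t : ℝ) (x : X) : V t (V (-t) x) = x := by
  simpa using V.neg_apply_apply (-t) x

theorem tendsto_antiDual_apply {ι : Type*} {l : Filter ι} {φ : ι → AntiDual X} {φ₀ : AntiDual X}
    {x : ι → X} {x₀ : X} (hφ : Tendsto φ l (𝓝 φ₀)) (hx : Tendsto x l (𝓝 x₀)) :
    Tendsto (fun i => φ i (x i)) l (𝓝 (φ₀ x₀)) := by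
  have h1 : Tendsto (fun i => ‖φ i - φ₀‖ * ‖x i‖) l (𝓝 (0 * ‖x₀‖)) :=
    (tendsto_iff_norm_sub_tendsto_zero.1 hφ).mul hx.norm
  rw [zero_mul] at h1
  have h2 : Tendsto (fun i => (φ i - φ₀) (x i)) l (𝓝 0) :=
    squeeze_zero_norm (fun i => (φ i - φ₀).le_opNorm (x i)) h1
  have h3 := h2.add ((φ₀.continuous.tendsto x₀).comp hx)
  simpa using h3

theorem exists_bound_of_continuous_orbit [CompleteSpace X] {F : ℝ → X →L[ℂ] Y}
    (hF : ∀ x, Continuous fun t => F t x) (a : ℝ) :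
    ∃ C, 0 ≤ C ∧ ∀ t ∈ Set.Icc (-a) a, ‖F t‖ ≤ C := by
  obtain ⟨C, hC⟩ := banach_steinhaus (g := fun t : Set.Icc (-a) a => F t) (fun x => by
    obtain ⟨C, hC⟩ := (isCompact_Icc (a := -a) (b := a)).exists_bound_of_continuousOn
      (hF x).continuousOn
    exact ⟨C, fun t => hC t t.2⟩)
  exact ⟨max C 0, le_max_right _ _, fun t ht => (hC ⟨t, ht⟩).trans (le_max_left _ _)⟩

theorem C0Group.tendsto_apply [CompleteSpace X] (V : C0Group X) {x : ℝ → X} {x₀ : X}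
    {l : Filter ℝ} (hl : l ≤ 𝓝 0) (hx : Tendsto x l (𝓝 x₀)) :
    Tendsto (fun t => V (-t) (x t)) l (𝓝 x₀) := by
  obtain ⟨C, hC0, hC⟩ := exists_bound_of_continuous_orbit V.continuous_orbit 1
  have h1 : Tendsto (fun t => C * ‖x t - x₀‖) l (𝓝 0) := by
    simpa using (tendsto_iff_norm_sub_tendsto_zero.1 hx).const_mul C
  have hnear : ∀ᶠ t in l, -t ∈ Set.Icc (-1 : ℝ) 1 := by
    refine hl ?_
    filter_upwards [Icc_mem_nhds (show (-1 : ℝ) < 0 by norm_num) one_pos] with t ht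
    exact ⟨neg_le_neg ht.2, neg_le.1 ht.1⟩
  have h2 : Tendsto (fun t => V (-t) (x t - x₀)) l (𝓝 0) := by
    refine squeeze_zero_norm' ?_ h1
    filter_upwards [hnear] with t ht
    exact (V (-t)).le_of_opNorm_le (hC _ ht) _
  have h3 : Tendsto (fun t => V (-t) x₀) l (𝓝 x₀) := by
    have := ((V.continuous_orbit x₀).comp continuous_neg).tendsto 0
    simp only [Function.comp_def, neg_zero, V.map_zero] at this
    exact this.mono_left hl
  have h4 := h2.add h3
  simpa using h4

/-- The conjugated operator `V (-t) K (V t)`, acting from a space to its anti-dual; as a form it is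
`(x, y) ↦ K (V t x) (V t y)`. -/
def conjForm (V : C0Group X) (K : X →L[ℂ] AntiDual X) (t : ℝ) : X →L[ℂ] AntiDual X :=
  (dualGroup V (-t)).comp (K.comp (V t))

theorem conjForm_apply (V : C0Group X) (K : X →L[ℂ] AntiDual X) (t : ℝ) (x y : X) :
    conjForm V K t x y = K (V t x) (V t y) := by
  change K (V t x) (V (- -t) y) = _
  rw [neg_neg]

theorem conjForm_zero (V : C0Group X) (K : X →L[ℂ] AntiDual X) (x : X) :
    conjForm V K 0 x = K x := by
  ext y
  rw [conjForm_apply, V.map_zero]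
  rfl

theorem continuous_conjForm {V : C0Group X} {K : X →L[ℂ] AntiDual X}
    (hK : IsC1 V (dualGroup V) K) (x : X) : Continuous fun t => conjForm V K t x :=
  (hK x).continuous

/-- The derivative of `V (-t) K (V t)` at `t = 0` is a bounded operator, by the
uniform boundedness principle. -/
theorem exists_hasDerivAt_conjForm [CompleteSpace X] {V : C0Group X} {K : X →L[ℂ] AntiDual X}
    (hK : IsC1 V (dualGroup V) K) :
    ∃ K' : X →L[ℂ] AntiDual X, ∀ x, HasDerivAt (fun t => conjForm V K t x) (K' x) 0 := by
  have hd : ∀ x, HasDerivAt (fun t => conjForm V K t x)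
      (deriv (fun t => conjForm V K t x) 0) 0 := fun x => (hK x 0).hasDerivAt
  let u : ℕ → ℝ := fun n => 1 / ((n : ℝ) + 1)
  have hu : Tendsto u atTop (𝓝[≠] 0) :=
    tendsto_nhdsWithin_iff.2 ⟨tendsto_one_div_add_atTop_nhds_zero_nat,
      Eventually.of_forall fun n => (Nat.one_div_pos_of_nat (α := ℝ)).ne'⟩
  let g : ℕ → X →L[ℂ] AntiDual X := fun n =>
    (((u n)⁻¹ : ℝ) : ℂ) • (conjForm V K (u n) - conjForm V K 0)
  have hg : Tendsto (fun n x => g n x) atTop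
      (𝓝 fun x => deriv (fun t => conjForm V K t x) 0) := by
    rw [tendsto_pi_nhds]
    intro x
    have h := (hasDerivAt_iff_tendsto_slope.1 (hd x)).comp hu
    refine h.congr fun n => ?_
    change (u n - 0)⁻¹ • (conjForm V K (u n) x - conjForm V K 0 x) =
      (((u n)⁻¹ : ℝ) : ℂ) • (conjForm V K (u n) x - conjForm V K 0 x)
    rw [sub_zero]
    ext y
    exact Complex.real_smul
  exact ⟨continuousLinearMapOfTendsto g hg, hd⟩

/-- The increment from `0` to `t` of `s ↦ V (-s) (H - z - iεK) (V s)` when `V (-s) K (V s)` is the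
derivative of `V (-s) H (V s)`. The increment of the first term is written as an integral because
that expression makes sense as a bounded operator from `X` to its anti-dual, which `H` is not. -/
def increment (V : C0Group X) (K : X →L[ℂ] AntiDual X) (ε t : ℝ) (x : X) : AntiDual X :=
  (∫ s in (0 : ℝ)..t, conjForm V K s x) - (I * (ε : ℂ)) • (conjForm V K t x - K x)

theorem continuous_increment [CompleteSpace X] {V : C0Group X} {K : X →L[ℂ] AntiDual X}
    (hK : IsC1 V (dualGroup V) K) (ε t : ℝ) : Continuous (increment V K ε t) := by
  have hi : ∀ x, IntervalIntegrable (fun s => conjForm V K s x) volume 0 t := fun x =>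
    (continuous_conjForm hK x).intervalIntegrable _ _
  obtain ⟨C, hC0, hC⟩ := exists_bound_of_continuous_orbit (continuous_conjForm hK) |t|
  let N : X →ₗ[ℂ] AntiDual X :=
    { toFun := fun x => ∫ s in (0 : ℝ)..t, conjForm V K s x
      map_add' := fun x y => by
        simp only [map_add]
        exact intervalIntegral.integral_add (hi x) (hi y)
      map_smul' := fun c x => by
        simp only [map_smul, RingHom.id_apply]
        exact intervalIntegral.integral_smul c _ }
  have hN : ∀ x, ‖N x‖ ≤ (C * |t|) * ‖x‖ := by
    intro x
    have h := intervalIntegral.norm_integral_le_of_norm_le_const (a := 0) (b := t)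
      (f := fun s => conjForm V K s x) (C := C * ‖x‖) (fun s hs => by
        refine (conjForm V K s).le_of_opNorm_le (hC s ?_) x
        rw [Set.mem_Icc, ← abs_le]
        rcases Set.mem_uIoc.1 hs with h | h
        · rw [abs_of_pos h.1]; exact h.2.trans (le_abs_self t)
        · rw [abs_of_nonpos h.2]; exact (neg_le_neg h.1.le).trans (neg_le_abs t))
    refine h.trans_eq ?_
    rw [sub_zero]; ring
  have hNc : Continuous N := (N.mkContinuous _ hN).continuous
  exact hNc.sub (((conjForm V K t) - K).continuous.const_smul (I * (ε : ℂ)))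

theorem increment_zero (V : C0Group X) (K : X →L[ℂ] AntiDual X) (ε : ℝ) (x : X) :
    increment V K ε 0 x = 0 := by
  rw [increment, intervalIntegral.integral_same, conjForm_zero, sub_self, smul_zero, sub_zero]

theorem hasDerivAt_increment {V : C0Group X} {K K' : X →L[ℂ] AntiDual X}
    (hK : IsC1 V (dualGroup V) K)
    (hK' : ∀ x, HasDerivAt (fun t => conjForm V K t x) (K' x) 0) (ε : ℝ) (x : X) :
    HasDerivAt (fun t => increment V K ε t x) (K x - (I * (ε : ℂ)) • K' x) 0 := by
  have h1 : HasDerivAt (fun t => ∫ s in (0 : ℝ)..t, conjForm V K s x) (K x) 0 := by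
    have h := (continuous_conjForm hK x).integral_hasStrictDerivAt 0 0
    simpa only [conjForm_zero] using h.hasDerivAt
  exact h1.sub (((hK' x).sub_const (K x)).const_smul (I * (ε : ℂ)))

/-- The commutator identity `G [iH, A] G = i (A G - G A) + iε G K' G` for `G = (H - z - iεK)⁻¹`,
`K = [iH, A]` and `K' = [iK, A]`, as an estimate for the quadratic form on the domain of `A`.
The hypothesis `hcov` is the integrated form of the identity: it compares `G` with its conjugate by
the group, up to a factor `V t` on the left. -/
theorem norm_form_commutator_le [CompleteSpace X] {V : C0Group X} {K K' : X →L[ℂ] AntiDual X}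
    (hK : IsC1 V (dualGroup V) K)
    (hK' : ∀ x, HasDerivAt (fun t => conjForm V K t x) (K' x) 0) {ε : ℝ} (hε : 0 ≤ ε)
    {G G' : AntiDual X →L[ℂ] X} (hadj : ∀ φ ψ : AntiDual X, ψ (G φ) = conj (φ (G' ψ)))
    (hcov : ∀ t φ, G (dualGroup V t φ) - V t (G φ) =
      -G (dualGroup V t (increment V K ε t (G φ))))
    (h : (generator (dualGroup V)).domain) :
    ‖(h : AntiDual X) (G (K (G h)))‖ ≤
      ‖generator (dualGroup V) h‖ * (‖G h‖ + ‖G' h‖) + ε * ‖K'‖ * ‖G h‖ * ‖G' h‖ := by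
  obtain ⟨h, hh⟩ := h
  set h' : AntiDual X := deriv (fun t => dualGroup V t h) 0 with hh'
  have hd : HasDerivAt (fun t => dualGroup V t h) h' 0 := DifferentiableAt.hasDerivAt hh
  have hgen : ‖generator (dualGroup V) ⟨h, hh⟩‖ = ‖h'‖ := by
    change ‖(-I) • h'‖ = _
    rw [norm_smul, norm_neg, norm_I, one_mul]
  rw [hgen]
  simp only
  have hV0 : dualGroup V 0 h = h := by
    ext x
    rw [dualGroup_apply, neg_zero, V.map_zero]
    rfl
  -- the identity before the passage to the limit
  have key : ∀ t, ‖(t⁻¹ • increment V K ε t (G h)) (V (-t) (G' (dualGroup V t h)))‖ ≤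
      ‖t⁻¹ • (dualGroup V t h - h)‖ * (‖G (dualGroup V t h)‖ + ‖G' h‖) := by
    intro t
    set k := dualGroup V t h with hk
    have e1 : k (V t (G h)) = h (G h) := by
      rw [hk, dualGroup_apply, V.neg_apply_apply]
    have e2 : k (G k) - h (G h) = (k - h) (G k) + h (G (k - h)) := by
      rw [map_sub, map_sub, sub_apply]; ring
    have e3 : k (G k) - h (G h) =
        -conj (increment V K ε t (G h) (V (-t) (G' k))) := by
      rw [← e1, ← map_sub, hcov, map_neg, hadj]
      rfl
    have e4 : ‖increment V K ε t (G h) (V (-t) (G' k))‖ ≤ ‖k - h‖ * (‖G k‖ + ‖G' h‖) := by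
      rw [← RCLike.norm_conj, ← norm_neg, ← e3, e2, mul_add]
      refine (norm_add_le _ _).trans (add_le_add ((k - h).le_opNorm _) ?_)
      rw [hadj, RCLike.norm_conj]
      exact (k - h).le_opNorm _
    rw [norm_smul, mul_assoc]
    change ‖t⁻¹ • (increment V K ε t (G h) (V (-t) (G' k)))‖ ≤ _
    rw [norm_smul]
    exact mul_le_mul_of_nonneg_left e4 (norm_nonneg _)
  have hslope : Tendsto (fun t : ℝ => t⁻¹ • (dualGroup V t h - h)) (𝓝[≠] 0) (𝓝 h') := by
    have := hasDerivAt_iff_tendsto_slope.1 hd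
    refine this.congr fun t => ?_
    simp only [slope, sub_zero, vsub_eq_sub, hV0]
  have hinc : Tendsto (fun t : ℝ => t⁻¹ • increment V K ε t (G h)) (𝓝[≠] 0)
      (𝓝 (K (G h) - (I * (ε : ℂ)) • K' (G h))) := by
    have := hasDerivAt_iff_tendsto_slope.1 (hasDerivAt_increment hK hK' ε (G h))
    refine this.congr fun t => ?_
    simp only [slope, sub_zero, vsub_eq_sub, increment_zero]
  have hk0 : Tendsto (fun t => dualGroup V t h) (𝓝[≠] 0) (𝓝 h) := by
    have := hd.continuousAt.tendsto
    rw [hV0] at this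
    exact this.mono_left nhdsWithin_le_nhds
  have hl : Tendsto (fun t : ℝ =>
      ‖(t⁻¹ • increment V K ε t (G h)) (V (-t) (G' (dualGroup V t h)))‖) (𝓝[≠] 0)
      (𝓝 ‖(K (G h) - (I * (ε : ℂ)) • K' (G h)) (G' h)‖) :=
    (tendsto_antiDual_apply hinc (V.tendsto_apply nhdsWithin_le_nhds
      ((G'.continuous.tendsto h).comp hk0))).norm
  have hr := hslope.norm.mul ((((G.continuous.tendsto h).comp hk0).norm).add_const ‖G' h‖)
  have hlim := le_of_tendsto_of_tendsto' hl hr key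
  have e5 : h (G (K (G h))) = conj ((K (G h)) (G' h)) := hadj _ _
  have e6 : (K (G h)) (G' h) = (K (G h) - (I * (ε : ℂ)) • K' (G h)) (G' h)
      + (I * (ε : ℂ)) * (K' (G h)) (G' h) := by
    rw [sub_apply, smul_apply, smul_eq_mul]; ring
  rw [e5, RCLike.norm_conj, e6]
  refine (norm_add_le _ _).trans (add_le_add hlim ?_)
  rw [norm_mul, norm_mul, norm_I, one_mul, Complex.norm_real, Real.norm_of_nonneg hε, mul_assoc,
    mul_assoc]
  refine mul_le_mul_of_nonneg_left ?_ hε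
  rw [← mul_assoc]
  exact ((K' (G h)).le_opNorm _).trans
    (mul_le_mul_of_nonneg_right (K'.le_opNorm _) (norm_nonneg _))

end OneParameterFamilies

/-! ### The differential inequality -/

section DifferentialInequality

variable {X : Type*} [NormedAddCommGroup X] [NormedSpace ℂ X]

/-- The properties of the regularized resolvents `G ε = (H - z - iεK)⁻¹`, `0 < ε ≤ ε₀`, and of
their adjoints `G' ε`, as operators from the anti-dual of the energy space `X` to `X`, that lead to
the limiting absorption principle. The constant `C` is a bound for `[iK, A]`. Nothing here refers
to `z`, so that the resulting estimates are uniform in it. -/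
structure RegularizedFamily (A : AntiDual X →ₗ.[ℂ] AntiDual X) (K : X →L[ℂ] AntiDual X)
    (C ε₀ : ℝ) where
  /-- The regularized resolvent. -/
  G : ℝ → AntiDual X →L[ℂ] X
  /-- Its adjoint. -/
  G' : ℝ → AntiDual X →L[ℂ] X
  adj : ∀ ε ∈ Set.Ioc 0 ε₀, ∀ φ ψ : AntiDual X, ψ (G ε φ) = conj (φ (G' ε ψ))
  coercive : ∀ ε ∈ Set.Ioc 0 ε₀, ∀ φ : AntiDual X, ε * ‖G ε φ‖ ^ 2 ≤ 2 * ‖φ (G ε φ)‖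
  coercive' : ∀ ε ∈ Set.Ioc 0 ε₀, ∀ φ : AntiDual X, ε * ‖G' ε φ‖ ^ 2 ≤ 2 * ‖φ (G' ε φ)‖
  resolvent_sub : ∀ ε ∈ Set.Ioc 0 ε₀, ∀ δ ∈ Set.Ioc 0 ε₀, ∀ φ : AntiDual X,
    G ε φ - G δ φ = (I * ((ε - δ : ℝ) : ℂ)) • G ε (K (G δ φ))
  form_commutator_le : ∀ ε ∈ Set.Ioc 0 ε₀, ∀ h : A.domain,
    ‖(h : AntiDual X) (G ε (K (G ε h)))‖ ≤
      ‖A h‖ * (‖G ε h‖ + ‖G' ε h‖) + ε * C * ‖G ε h‖ * ‖G' ε h‖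

namespace RegularizedFamily

variable {A : AntiDual X →ₗ.[ℂ] AntiDual X} {K : X →L[ℂ] AntiDual X} {C ε₀ : ℝ}
  (R : RegularizedFamily A K C ε₀)

theorem le_sqrt_mul {ε a b Y : ℝ} (hε : 0 < ε) (hY : 0 ≤ Y)
    (h : ε * a ^ 2 ≤ 2 * b) (hb : b ≤ Y ^ 2) : a ≤ √(2 / ε) * Y := by
  refine le_of_sq_le_sq ?_ (by positivity)
  rw [mul_pow, Real.sq_sqrt (by positivity), div_mul_eq_mul_div, le_div_iff₀ hε]
  nlinarith

theorem norm_G_le {ε Y : ℝ} (hε : ε ∈ Set.Ioc 0 ε₀) (hY : 0 ≤ Y) {φ : AntiDual X}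
    (h : ‖φ (R.G ε φ)‖ ≤ Y ^ 2) : ‖R.G ε φ‖ ≤ √(2 / ε) * Y :=
  le_sqrt_mul hε.1 hY (R.coercive ε hε φ) h

theorem norm_form_adj {ε : ℝ} (hε : ε ∈ Set.Ioc 0 ε₀) (φ : AntiDual X) :
    ‖φ (R.G' ε φ)‖ = ‖φ (R.G ε φ)‖ := by
  rw [R.adj ε hε, RCLike.norm_conj]

theorem norm_G'_le {ε Y : ℝ} (hε : ε ∈ Set.Ioc 0 ε₀) (hY : 0 ≤ Y) {φ : AntiDual X}
    (h : ‖φ (R.G ε φ)‖ ≤ Y ^ 2) : ‖R.G' ε φ‖ ≤ √(2 / ε) * Y :=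
  le_sqrt_mul hε.1 hY (R.coercive' ε hε φ) (by rwa [R.norm_form_adj hε])

theorem norm_G_le_div {ε : ℝ} (hε : ε ∈ Set.Ioc 0 ε₀) (φ : AntiDual X) :
    ‖R.G ε φ‖ ≤ 2 / ε * ‖φ‖ := by
  have h1 := (R.coercive ε hε φ).trans
    (mul_le_mul_of_nonneg_left (φ.le_opNorm (R.G ε φ)) zero_le_two)
  rw [div_mul_eq_mul_div, le_div_iff₀ hε.1]
  rcases (norm_nonneg (R.G ε φ)).eq_or_lt with h | h
  · rw [← h, zero_mul]; positivity
  · refine le_of_mul_le_mul_right ?_ h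
    nlinarith

theorem norm_form_le {ε : ℝ} (hε : ε ∈ Set.Ioc 0 ε₀) (φ : AntiDual X) :
    ‖φ (R.G ε φ)‖ ≤ 2 / ε * ‖φ‖ ^ 2 := by
  refine (φ.le_opNorm _).trans ?_
  calc ‖φ‖ * ‖R.G ε φ‖ ≤ ‖φ‖ * (2 / ε * ‖φ‖) :=
        mul_le_mul_of_nonneg_left (R.norm_G_le_div hε φ) (norm_nonneg _)
    _ = _ := by ring

/-- The values of the form at two functionals, compared at the same `ε`. -/
theorem norm_form_sub_le {ε : ℝ} (hε : ε ∈ Set.Ioc 0 ε₀) (φ ψ : AntiDual X) {Y Z : ℝ}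
    (hY : 0 ≤ Y) (hZ : 0 ≤ Z) (hφ : ‖φ (R.G ε φ)‖ ≤ Y ^ 2) (hψ : ‖ψ (R.G ε ψ)‖ ≤ Z ^ 2) :
    ‖φ (R.G ε φ) - ψ (R.G ε ψ)‖ ≤ ‖φ - ψ‖ * √(2 / ε) * (Y + Z) := by
  have e : φ (R.G ε φ) - ψ (R.G ε ψ) = (φ - ψ) (R.G ε φ) + conj ((φ - ψ) (R.G' ε ψ)) := by
    rw [← R.adj ε hε, map_sub, map_sub, sub_apply]; ring
  rw [e]
  refine (norm_add_le _ _).trans ?_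
  rw [RCLike.norm_conj, mul_assoc, mul_add, mul_add]
  exact add_le_add (((φ - ψ).le_opNorm _).trans
      (mul_le_mul_of_nonneg_left (R.norm_G_le hε hY hφ) (norm_nonneg _)))
    (((φ - ψ).le_opNorm _).trans
      (mul_le_mul_of_nonneg_left (R.norm_G'_le hε hZ hψ) (norm_nonneg _)))

theorem hasDerivWithinAt_form {a b ε : ℝ} (ha : 0 < a) (hb : b ≤ ε₀) (hε : ε ∈ Set.Icc a b)
    (φ : AntiDual X) :
    HasDerivWithinAt (fun δ => φ (R.G δ φ)) (φ (I • R.G ε (K (R.G ε φ)))) (Set.Icc a b) ε := by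
  have hmem : ∀ δ ∈ Set.Icc a b, δ ∈ Set.Ioc 0 ε₀ := fun δ hδ =>
    ⟨ha.trans_le hδ.1, hδ.2.trans hb⟩
  rw [hasDerivWithinAt_iff_tendsto_slope]
  set y := K (R.G ε φ) with hy
  have hcont : Tendsto (fun δ => R.G δ y) (𝓝[Set.Icc a b \ {ε}] ε) (𝓝 (R.G ε y)) := by
    rw [tendsto_iff_norm_sub_tendsto_zero]
    have h0 : Tendsto (fun δ : ℝ => |δ - ε| * (2 / a * ‖K (R.G ε y)‖)) (𝓝 ε) (𝓝 0) := by
      have : Continuous fun δ : ℝ => |δ - ε| * (2 / a * ‖K (R.G ε y)‖) := by fun_prop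
      simpa using this.tendsto ε
    refine squeeze_zero' (Eventually.of_forall fun δ => norm_nonneg _) ?_
      (h0.mono_left nhdsWithin_le_nhds)
    filter_upwards [self_mem_nhdsWithin] with δ hδ
    rw [R.resolvent_sub δ (hmem δ hδ.1) ε (hmem ε hε), norm_smul, norm_mul, norm_I, one_mul,
      Complex.norm_real, Real.norm_eq_abs]
    refine mul_le_mul_of_nonneg_left ((R.norm_G_le_div (hmem δ hδ.1) _).trans ?_) (abs_nonneg _)
    exact mul_le_mul_of_nonneg_right (div_le_div_of_nonneg_left zero_le_two ha hδ.1.1)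
      (norm_nonneg _)
  refine ((φ.continuous.tendsto _).comp (hcont.const_smul I)).congr' ?_
  filter_upwards [self_mem_nhdsWithin] with δ hδ
  have hne : δ - ε ≠ 0 := sub_ne_zero.2 hδ.2
  have e : φ (R.G δ φ) - φ (R.G ε φ) = ((δ - ε : ℝ) : ℂ) * φ (I • R.G δ y) := by
    rw [← map_sub, R.resolvent_sub δ (hmem δ hδ.1) ε (hmem ε hε), mul_comm I, mul_smul,
      map_smulₛₗ, Complex.conj_ofReal, smul_eq_mul]
  rw [slope, vsub_eq_sub, e, Complex.real_smul, ← mul_assoc, ← Complex.ofReal_mul,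
    inv_mul_cancel₀ hne, Complex.ofReal_one, one_mul]
  rfl

theorem norm_form_sub_le_of_mem_domain (hC : 0 ≤ C) {a b : ℝ} (ha : 0 < a) (hab : a ≤ b)
    (hb : b ≤ ε₀) (h : A.domain) {Y : ℝ} (hY : 0 ≤ Y)
    (hbd : ∀ ε ∈ Set.Icc a b, ‖(h : AntiDual X) (R.G ε h)‖ ≤ Y ^ 2) :
    ‖(h : AntiDual X) (R.G b h) - (h : AntiDual X) (R.G a h)‖ ≤
      (‖A h‖ * (2 * √(2 / a) * Y) + 2 * C * Y ^ 2) * (b - a) := by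
  have hmem : ∀ δ ∈ Set.Icc a b, δ ∈ Set.Ioc 0 ε₀ := fun δ hδ =>
    ⟨ha.trans_le hδ.1, hδ.2.trans hb⟩
  have := Convex.norm_image_sub_le_of_norm_hasDerivWithin_le
    (C := ‖A h‖ * (2 * √(2 / a) * Y) + 2 * C * Y ^ 2)
    (fun ε hε => R.hasDerivWithinAt_form ha hb hε (h : AntiDual X)) (fun ε hε => ?_)
    (convex_Icc a b) (Set.left_mem_Icc.2 hab) (Set.right_mem_Icc.2 hab)
  · rwa [Real.norm_of_nonneg (sub_nonneg.2 hab)] at this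
  · have hε' := hmem ε hε
    have hε0 := hε'.1
    rw [map_smulₛₗ, norm_smul, RCLike.norm_conj, norm_I, one_mul]
    refine (R.form_commutator_le ε hε' h).trans ?_
    have h1 := R.norm_G_le hε' hY (hbd ε hε)
    have h2 := R.norm_G'_le hε' hY (hbd ε hε)
    have h3 : √(2 / ε) ≤ √(2 / a) :=
      Real.sqrt_le_sqrt (div_le_div_of_nonneg_left zero_le_two ha hε.1)
    refine add_le_add (mul_le_mul_of_nonneg_left ?_ (norm_nonneg _)) ?_
    · have := mul_le_mul_of_nonneg_right h3 hY
      linarith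
    · calc ε * C * ‖R.G ε h‖ * ‖R.G' ε h‖ = ε * C * (‖R.G ε h‖ * ‖R.G' ε h‖) := by ring
        _ ≤ ε * C * ((√(2 / ε) * Y) * (√(2 / ε) * Y)) := by gcongr
        _ = ε * C * (√(2 / ε) ^ 2 * Y ^ 2) := by ring
        _ = 2 * C * Y ^ 2 := by
          rw [Real.sq_sqrt (by positivity)]; field_simp

end RegularizedFamily

end DifferentialInequality

/-! ### Summation over dyadic intervals -/

section DyadicArgument

variable {X : Type*} [NormedAddCommGroup X] [NormedSpace ℂ X]

namespace RegularizedFamily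

variable {A : AntiDual X →ₗ.[ℂ] AntiDual X} {K : X →L[ℂ] AntiDual X} {C ε₀ : ℝ}
  (R : RegularizedFamily A K C ε₀)

theorem dyadic_pos (hε₀ : 0 < ε₀) (n : ℕ) : 0 < ε₀ / 2 ^ n := by positivity

theorem dyadic_succ (n : ℕ) : ε₀ / 2 ^ (n + 1) = ε₀ / 2 ^ n / 2 := by
  rw [pow_succ, div_div]

theorem dyadic_le (hε₀ : 0 < ε₀) (n : ℕ) : ε₀ / 2 ^ n ≤ ε₀ :=
  div_le_self hε₀.le (one_le_pow₀ one_le_two)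

theorem dyadic_mem (hε₀ : 0 < ε₀) {n : ℕ} {ε : ℝ}
    (hε : ε ∈ Set.Icc (ε₀ / 2 ^ (n + 1)) (ε₀ / 2 ^ n)) : ε ∈ Set.Ioc 0 ε₀ :=
  ⟨(dyadic_pos hε₀ _).trans_le hε.1, hε.2.trans (dyadic_le hε₀ n)⟩

theorem sqrt_two_div_le (hε₀ : 0 < ε₀) {n : ℕ} {ε : ℝ} (hε : ε₀ / 2 ^ (n + 1) ≤ ε) :
    √(2 / ε) ≤ 2 / √(ε₀ / 2 ^ n) := by
  have he := dyadic_pos hε₀ n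
  rw [dyadic_succ] at hε
  rw [← Real.sqrt_sq (show (0 : ℝ) ≤ 2 / √(ε₀ / 2 ^ n) by positivity), div_pow,
    Real.sq_sqrt he.le]
  refine Real.sqrt_le_sqrt ?_
  rw [div_le_div_iff₀ (by linarith) he]
  linarith

/-- The variation over one dyadic interval, for the functional attached to that interval. -/
theorem dyadic_drift_le (hC : 0 ≤ C) (hε₀ : 0 < ε₀) {n : ℕ} {h : A.domain} {s Y : ℝ}
    (hs : ε₀ / 2 ^ n * ‖A h‖ ≤ √(ε₀ / 2 ^ n) * s) (hY : 0 ≤ Y)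
    (hbd : ∀ ε ∈ Set.Icc (ε₀ / 2 ^ (n + 1)) (ε₀ / 2 ^ n), ‖(h : AntiDual X) (R.G ε h)‖ ≤ Y ^ 2)
    {ε : ℝ} (hε : ε ∈ Set.Icc (ε₀ / 2 ^ (n + 1)) (ε₀ / 2 ^ n)) :
    ‖(h : AntiDual X) (R.G ε h)‖ ≤ ‖(h : AntiDual X) (R.G (ε₀ / 2 ^ n) h)‖ +
      2 * s * Y + 2 * C * Y ^ 2 * (ε₀ / 2 ^ n - ε) := by
  have he := dyadic_pos hε₀ n
  set e := ε₀ / 2 ^ n with he_def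
  have hε1 := (dyadic_mem hε₀ hε).1
  have h1 := R.norm_form_sub_le_of_mem_domain hC hε1 hε.2 (dyadic_le hε₀ n) h hY
    (fun δ hδ => hbd δ ⟨hε.1.trans hδ.1, hδ.2⟩)
  have h2 := norm_sub_norm_le ((h : AntiDual X) (R.G ε h)) ((h : AntiDual X) (R.G e h))
  rw [norm_sub_rev] at h2
  have hr := sqrt_two_div_le hε₀ hε.1
  have hr0 : 0 < √e := Real.sqrt_pos.2 he
  have hsq : √e * √e = e := Real.mul_self_sqrt he.le
  have hlen : e - ε ≤ e / 2 := by
    have := hε.1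
    rw [dyadic_succ] at this
    linarith
  have hA : ‖A h‖ * √e ≤ s := by
    refine le_of_mul_le_mul_left ?_ hr0
    calc √e * (‖A h‖ * √e) = (√e * √e) * ‖A h‖ := by ring
      _ ≤ _ := by rw [hsq]; exact hs
  have h3 : ‖A h‖ * (2 * √(2 / ε) * Y) * (e - ε) ≤ 2 * s * Y := by
    calc ‖A h‖ * (2 * √(2 / ε) * Y) * (e - ε)
        ≤ ‖A h‖ * (2 * (2 / √e) * Y) * (e / 2) := by
          have : 0 ≤ e - ε := sub_nonneg.2 hε.2
          gcongr
      _ = 2 * (‖A h‖ * √e) * Y := by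
          conv_lhs => enter [2, 1]; rw [← hsq]
          field_simp
      _ ≤ 2 * s * Y := by gcongr
  nlinarith

/-- If all the values of the form along the dyadic path are at most `Y²`, then they are bounded by
the initial value, a term linear in `Y`, and a small multiple of `Y²`. -/
theorem dyadic_path_le (hC : 0 ≤ C) (hε₀ : 0 < ε₀) (hCε : 4 * C * ε₀ ≤ 1) {f : AntiDual X}
    {g : ℕ → A.domain} {s : ℕ → ℝ} {T Y : ℝ} {N : ℕ}
    (hg : ∀ n, ‖f - g n‖ + ε₀ / 2 ^ n * (‖(g n : AntiDual X)‖ + ‖A (g n)‖) ≤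
      √(ε₀ / 2 ^ n) * s n)
    (hs : ∀ n, 0 ≤ s n) (hT : ∀ n, ∑ k ∈ Finset.range n, s k ≤ T) (hY : 0 ≤ Y)
    (hbd : ∀ n ≤ N, ∀ ε ∈ Set.Icc (ε₀ / 2 ^ (n + 1)) (ε₀ / 2 ^ n),
      ‖(g n : AntiDual X) (R.G ε (g n))‖ ≤ Y ^ 2) :
    ∀ n ≤ N, ∀ ε ∈ Set.Icc (ε₀ / 2 ^ (n + 1)) (ε₀ / 2 ^ n),
      ‖(g n : AntiDual X) (R.G ε (g n))‖ ≤
        ‖(g 0 : AntiDual X) (R.G ε₀ (g 0))‖ + 10 * T * Y + Y ^ 2 / 2 := by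
  set F := ‖(g 0 : AntiDual X) (R.G ε₀ (g 0))‖ with hF
  have hsA : ∀ n, ε₀ / 2 ^ n * ‖A (g n)‖ ≤ √(ε₀ / 2 ^ n) * s n := fun n => by
    refine le_trans ?_ (hg n)
    have := mul_nonneg (dyadic_pos hε₀ n).le (norm_nonneg (g n : AntiDual X))
    have := norm_nonneg (f - g n)
    rw [mul_add]; linarith
  have hsf : ∀ n, ‖f - g n‖ ≤ √(ε₀ / 2 ^ n) * s n := fun n => by
    refine le_trans ?_ (hg n)
    have := dyadic_pos hε₀ n
    exact le_add_of_nonneg_right (by positivity)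
  -- the values at the right ends of the dyadic intervals
  have step : ∀ n ≤ N, ‖(g n : AntiDual X) (R.G (ε₀ / 2 ^ n) (g n))‖ ≤
      F + (6 * ∑ k ∈ Finset.range n, s k + 4 * ∑ k ∈ Finset.range n, s (k + 1)) * Y +
        2 * C * Y ^ 2 * (ε₀ - ε₀ / 2 ^ n) := by
    intro n
    induction n with
    | zero => intro _; simp [hF]
    | succ n ih =>
      intro hn
      have ih := ih (Nat.le_of_succ_le hn)
      have he := dyadic_pos hε₀ n
      have hle : ε₀ / 2 ^ (n + 1) ≤ ε₀ / 2 ^ n := by rw [dyadic_succ]; linarith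
      have hleft : ε₀ / 2 ^ (n + 1) ∈ Set.Icc (ε₀ / 2 ^ (n + 1)) (ε₀ / 2 ^ n) := ⟨le_rfl, hle⟩
      have hright : ε₀ / 2 ^ (n + 1) ∈ Set.Icc (ε₀ / 2 ^ (n + 1 + 1)) (ε₀ / 2 ^ (n + 1)) := by
        refine ⟨?_, le_rfl⟩
        rw [dyadic_succ (n + 1)]
        linarith [dyadic_pos hε₀ (n + 1)]
      have h1 := R.dyadic_drift_le hC hε₀ (hsA n) hY (hbd n (Nat.le_of_succ_le hn)) hleft
      have h2 := R.norm_form_sub_le (dyadic_mem hε₀ hleft) (g (n + 1)) (g n) hY hY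
        (hbd _ hn _ hright) (hbd n (Nat.le_of_succ_le hn) _ hleft)
      have hr0 : 0 < √(ε₀ / 2 ^ n) := Real.sqrt_pos.2 he
      have h3 : ‖(g (n + 1) : AntiDual X) - g n‖ ≤ √(ε₀ / 2 ^ n) * (s n + s (n + 1)) := by
        have e : (g (n + 1) : AntiDual X) - g n = (f - g n) - (f - g (n + 1)) := by abel
        rw [e, mul_add]
        refine (norm_sub_le _ _).trans (add_le_add (hsf n) ((hsf (n + 1)).trans ?_))
        exact mul_le_mul_of_nonneg_right (Real.sqrt_le_sqrt hle) (hs _)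
      have h4 : ‖(g (n + 1) : AntiDual X) - g n‖ * √(2 / (ε₀ / 2 ^ (n + 1))) * (Y + Y) ≤
          4 * (s n + s (n + 1)) * Y := by
        have := hs n
        have := hs (n + 1)
        calc _ ≤ √(ε₀ / 2 ^ n) * (s n + s (n + 1)) * (2 / √(ε₀ / 2 ^ n)) * (Y + Y) := by
              gcongr
              exact sqrt_two_div_le hε₀ le_rfl
          _ = _ := by field_simp; ring
      have h5 := norm_sub_norm_le ((g (n + 1) : AntiDual X) (R.G (ε₀ / 2 ^ (n + 1)) (g (n + 1))))
        ((g n : AntiDual X) (R.G (ε₀ / 2 ^ (n + 1)) (g n)))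
      rw [Finset.sum_range_succ, Finset.sum_range_succ]
      linarith
  intro n hn ε hε
  have h1 := R.dyadic_drift_le hC hε₀ (hsA n) hY (hbd n hn) hε
  have h2 := step n hn
  have h3 : (6 * ∑ k ∈ Finset.range n, s k + 4 * ∑ k ∈ Finset.range n, s (k + 1)) * Y + 2 * s n * Y
      ≤ 10 * T * Y := by
    rw [← add_mul]
    refine mul_le_mul_of_nonneg_right ?_ hY
    have h4 := hT (n + 1)
    have h5 := h4
    rw [Finset.sum_range_succ] at h4
    rw [Finset.sum_range_succ'] at h5
    linarith [hs n, hs 0]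
  have h4 : 2 * C * Y ^ 2 * (ε₀ - ε) ≤ Y ^ 2 / 2 := by
    have h5 : 2 * C * Y ^ 2 * (ε₀ - ε) ≤ 2 * C * Y ^ 2 * ε₀ :=
      mul_le_mul_of_nonneg_left (by linarith [(dyadic_mem hε₀ hε).1]) (by positivity)
    nlinarith [sq_nonneg Y]
  linarith

/-- The bound on the regularized form by the interpolation data of `f`: the terms `s n` are
`(ε₀ / 2 ^ n) ^ (-1/2)` times almost optimal values of the `K`-functional at `ε₀ / 2 ^ n`. -/
theorem norm_form_dyadic_le (hC : 0 ≤ C) (hε₀ : 0 < ε₀) (hCε : 4 * C * ε₀ ≤ 1) {f : AntiDual X}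
    {g : ℕ → A.domain} {s : ℕ → ℝ} {T : ℝ}
    (hg : ∀ n, ‖f - g n‖ + ε₀ / 2 ^ n * (‖(g n : AntiDual X)‖ + ‖A (g n)‖) ≤
      √(ε₀ / 2 ^ n) * s n)
    (hs : ∀ n, 0 ≤ s n) (hT : ∀ n, ∑ k ∈ Finset.range n, s k ≤ T) (N : ℕ) :
    ‖f (R.G (ε₀ / 2 ^ N) f)‖ ≤ (24 / ε₀ ^ 2 + 1204) * T ^ 2 := by
  have hT0 : 0 ≤ T := hT 0
  let 𝒵 : Set ℝ := {y | ∃ n ≤ N, ∃ ε ∈ Set.Icc (ε₀ / 2 ^ (n + 1)) (ε₀ / 2 ^ n),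
    ‖(g n : AntiDual X) (R.G ε (g n))‖ = y}
  have hright : ∀ n, ε₀ / 2 ^ n ∈ Set.Icc (ε₀ / 2 ^ (n + 1)) (ε₀ / 2 ^ n) := fun n => by
    refine ⟨?_, le_rfl⟩
    rw [dyadic_succ]
    linarith [dyadic_pos hε₀ n]
  have hne : 𝒵.Nonempty := ⟨_, N, le_rfl, _, hright N, rfl⟩
  have hbdd : BddAbove 𝒵 := by
    refine ⟨∑ n ∈ Finset.range (N + 1), 2 / (ε₀ / 2 ^ (n + 1)) * ‖(g n : AntiDual X)‖ ^ 2, ?_⟩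
    rintro y ⟨n, hn, ε, hε, rfl⟩
    refine (R.norm_form_le (dyadic_mem hε₀ hε) _).trans ?_
    refine le_trans ?_ (Finset.single_le_sum
      (f := fun n => 2 / (ε₀ / 2 ^ (n + 1)) * ‖(g n : AntiDual X)‖ ^ 2)
      (fun k _ => by positivity) (Finset.mem_range.2 (Nat.lt_succ_of_le hn)))
    exact mul_le_mul_of_nonneg_right
      (div_le_div_of_nonneg_left zero_le_two (dyadic_pos hε₀ _) hε.1) (sq_nonneg _)
  set y := sSup 𝒵 with hy
  have hle : ∀ n ≤ N, ∀ ε ∈ Set.Icc (ε₀ / 2 ^ (n + 1)) (ε₀ / 2 ^ n),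
      ‖(g n : AntiDual X) (R.G ε (g n))‖ ≤ y := fun n hn ε hε =>
    le_csSup hbdd ⟨n, hn, ε, hε, rfl⟩
  have hy0 : 0 ≤ y := (norm_nonneg _).trans (hle N le_rfl _ (hright N))
  have hysq : √y ^ 2 = y := Real.sq_sqrt hy0
  have h1 := R.dyadic_path_le hC hε₀ hCε hg hs hT (Real.sqrt_nonneg y)
    (N := N) (fun n hn ε hε => (hle n hn ε hε).trans_eq hysq.symm)
  have h2 : y ≤ ‖(g 0 : AntiDual X) (R.G ε₀ (g 0))‖ + 10 * T * √y + √y ^ 2 / 2 := by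
    refine csSup_le hne ?_
    rintro _ ⟨n, hn, ε, hε, rfl⟩
    exact h1 n hn ε hε
  -- the initial value
  have h3 : ‖(g 0 : AntiDual X) (R.G ε₀ (g 0))‖ ≤ 2 / ε₀ ^ 2 * T ^ 2 := by
    have hs0 : s 0 ≤ T := by simpa using hT 1
    have h4 : ε₀ * ‖(g 0 : AntiDual X)‖ ≤ √ε₀ * T := by
      have := hg 0
      rw [pow_zero, div_one, mul_add] at this
      have h5 := mul_nonneg hε₀.le (norm_nonneg (A (g 0)))
      have h6 := norm_nonneg (f - g 0)
      have h7 := mul_le_mul_of_nonneg_left hs0 (Real.sqrt_nonneg ε₀)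
      linarith
    have h5 : ε₀ ^ 2 * ‖(g 0 : AntiDual X)‖ ^ 2 ≤ ε₀ * T ^ 2 := by
      have := pow_le_pow_left₀ (by positivity) h4 2
      rwa [mul_pow, mul_pow, Real.sq_sqrt hε₀.le] at this
    refine (R.norm_form_le ⟨hε₀, le_rfl⟩ _).trans ?_
    rw [div_mul_eq_mul_div, div_mul_eq_mul_div, div_le_div_iff₀ hε₀ (by positivity)]
    nlinarith
  have h4 : y ≤ (8 / ε₀ ^ 2 + 400) * T ^ 2 := by
    have h5 : 8 / ε₀ ^ 2 * T ^ 2 = 4 * (2 / ε₀ ^ 2 * T ^ 2) := by ring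
    nlinarith [sq_nonneg (√y - 20 * T)]
  -- the passage from `g N` to `f`
  set p := ‖f (R.G (ε₀ / 2 ^ N) f)‖ with hp
  have hp0 : 0 ≤ p := norm_nonneg _
  have hpsq : √p ^ 2 = p := Real.sq_sqrt hp0
  have h5 := R.norm_form_sub_le (dyadic_mem hε₀ (hright N)) f (g N) (Real.sqrt_nonneg p)
    (Real.sqrt_nonneg y) hpsq.ge ((hle N le_rfl _ (hright N)).trans_eq hysq.symm)
  have hsN : s N ≤ T := by
    refine le_trans ?_ (hT (N + 1))
    rw [Finset.sum_range_succ]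
    exact le_add_of_nonneg_left (Finset.sum_nonneg fun k _ => hs k)
  have h6 : ‖f - g N‖ * √(2 / (ε₀ / 2 ^ N)) ≤ √2 * T := by
    have he := dyadic_pos hε₀ N
    have hr0 : 0 < √(ε₀ / 2 ^ N) := Real.sqrt_pos.2 he
    have h7 : ‖f - g N‖ ≤ √(ε₀ / 2 ^ N) * T := by
      have := hg N
      have h8 : 0 ≤ ε₀ / 2 ^ N * (‖(g N : AntiDual X)‖ + ‖A (g N)‖) := by positivity
      have h9 := mul_le_mul_of_nonneg_left hsN hr0.le
      linarith
    rw [Real.sqrt_div zero_le_two]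
    calc _ ≤ √(ε₀ / 2 ^ N) * T * (√2 / √(ε₀ / 2 ^ N)) := by gcongr
      _ = _ := by field_simp
  have h7 : p ≤ y + √2 * T * (√p + √y) := by
    have h8 := norm_sub_norm_le (f (R.G (ε₀ / 2 ^ N) f)) ((g N : AntiDual X) (R.G (ε₀ / 2 ^ N) (g N)))
    have h9 := hle N le_rfl _ (hright N)
    have h10 := mul_le_mul_of_nonneg_right h6 (add_nonneg (Real.sqrt_nonneg p) (Real.sqrt_nonneg y))
    linarith
  have h2sq : √2 ^ 2 = (2 : ℝ) := Real.sq_sqrt zero_le_two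
  have h8 : √2 * T * √p ≤ T ^ 2 + p / 2 := by
    nlinarith [sq_nonneg (√2 * T - √p)]
  have h9 : √2 * T * √y ≤ T ^ 2 + y / 2 := by
    nlinarith [sq_nonneg (√2 * T - √y)]
  have h10 : (24 / ε₀ ^ 2 + 1204) * T ^ 2 = 3 * ((8 / ε₀ ^ 2 + 400) * T ^ 2) + 4 * T ^ 2 := by
    ring
  rw [h10]
  linarith

end RegularizedFamily

end DyadicArgument

/-! ### Dyadic approximation from the interpolation norm -/

section Interpolation

variable {Y : Type*} [NormedAddCommGroup Y] [NormedSpace ℂ Y]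

theorem kFunctional_mono (A : Y →ₗ.[ℂ] Y) (f : Y) {s t : ℝ} (h : s ≤ t) :
    kFunctional A s f ≤ kFunctional A t f :=
  iInf_mono fun g => by gcongr

theorem kFunctional_le_setLIntegral (A : Y →ₗ.[ℂ] Y) (f : Y) {e : ℝ} (he : 0 < e) :
    kFunctional A e f ≤ ENNReal.ofReal (2 * √2 * √e) *
      ∫⁻ t in Set.Ioo e (2 * e), ENNReal.ofReal (t ^ (-(3 / 2) : ℝ)) * kFunctional A t f := by
  have h2e : 0 < 2 * e := by positivity
  have h1 : ENNReal.ofReal ((2 * e) ^ (-(3 / 2) : ℝ)) * kFunctional A e f * ENNReal.ofReal e ≤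
      ∫⁻ t in Set.Ioo e (2 * e), ENNReal.ofReal (t ^ (-(3 / 2) : ℝ)) * kFunctional A t f := by
    have hvol : volume (Set.Ioo e (2 * e)) = ENNReal.ofReal e := by
      rw [Real.volume_Ioo]; congr 1; ring
    rw [← hvol, ← setLIntegral_const]
    refine setLIntegral_mono' measurableSet_Ioo fun t ht => ?_
    refine mul_le_mul' (ENNReal.ofReal_le_ofReal ?_) (kFunctional_mono A f ht.1.le)
    exact Real.rpow_le_rpow_of_nonpos (he.trans ht.1) ht.2.le (by norm_num)
  have h2 : (2 * √2 * √e) * ((2 * e) ^ (-(3 / 2) : ℝ) * e) = 1 := by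
    have h3 : (2 * e) ^ (-(3 / 2) : ℝ) = ((2 * e) * (√2 * √e))⁻¹ := by
      rw [← Real.sqrt_mul zero_le_two, Real.rpow_neg h2e.le,
        show (3 / 2 : ℝ) = 1 + 1 / 2 by norm_num, Real.rpow_add h2e, Real.rpow_one,
        Real.sqrt_eq_rpow]
    have h4 : √e ≠ 0 := (Real.sqrt_pos.2 he).ne'
    rw [h3]
    field_simp
  calc kFunctional A e f = ENNReal.ofReal ((2 * √2 * √e) * ((2 * e) ^ (-(3 / 2) : ℝ) * e)) *
        kFunctional A e f := by rw [h2, ENNReal.ofReal_one, one_mul]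
    _ = ENNReal.ofReal (2 * √2 * √e) *
        (ENNReal.ofReal ((2 * e) ^ (-(3 / 2) : ℝ)) * kFunctional A e f * ENNReal.ofReal e) := by
      rw [ENNReal.ofReal_mul (show 0 ≤ 2 * √2 * √e by positivity),
        ENNReal.ofReal_mul (Real.rpow_nonneg h2e.le _)]
      ring
    _ ≤ _ := by gcongr

/-- The real interpolation norm controls a dyadic sum of almost optimal values of
the `K`-functional. -/
theorem exists_dyadic_approx (A : Y →ₗ.[ℂ] Y) {f : Y} (hf : interpNorm A f < ⊤) {ε₀ : ℝ}
    (hε₀ : 0 < ε₀) {η : ℝ} (hη : 0 < η) :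
    ∃ (g : ℕ → A.domain) (s : ℕ → ℝ),
      (∀ n, ‖f - g n‖ + ε₀ / 2 ^ n * (‖(g n : Y)‖ + ‖A (g n)‖) ≤ √(ε₀ / 2 ^ n) * s n) ∧
      (∀ n, 0 ≤ s n) ∧
      ∀ n, ∑ k ∈ Finset.range n, s k ≤ 2 * √2 * (interpNorm A f).toReal + η := by
  let e : ℕ → ℝ := fun n => ε₀ / 2 ^ n
  have he : ∀ n, 0 < e n := fun n => by positivity
  let J : ℕ → ENNReal := fun n => ∫⁻ t in Set.Ioo (e n) (2 * e n),
    ENNReal.ofReal (t ^ (-(3 / 2) : ℝ)) * kFunctional A t f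
  have hJsum : ∀ n, ∑ k ∈ Finset.range n, J k ≤ interpNorm A f := by
    intro n
    have hdisj : ∀ k l, k < l → Disjoint (Set.Ioo (e k) (2 * e k)) (Set.Ioo (e l) (2 * e l)) := by
      intro k l hkl
      rw [Set.disjoint_left]
      intro t hk hl
      have h1 : 2 * e l ≤ e k := by
        have h2 : e l ≤ e (k + 1) :=
          div_le_div_of_nonneg_left hε₀.le (by positivity) (pow_le_pow_right₀ one_le_two hkl)
        have h3 : 2 * e (k + 1) = e k := by
          change 2 * (ε₀ / 2 ^ (k + 1)) = ε₀ / 2 ^ k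
          rw [pow_succ]; field_simp
        linarith
      exact absurd (hk.1.trans (hl.2.trans_le h1)) (lt_irrefl _)
    rw [← lintegral_biUnion_finset (t := fun k => Set.Ioo (e k) (2 * e k)) ?_
      (fun _ _ => measurableSet_Ioo)]
    · refine lintegral_mono_set ?_
      exact Set.iUnion₂_subset fun k _ t ht => (he k).trans ht.1
    · intro k _ l _ hkl
      rcases lt_or_gt_of_ne hkl with h | h
      · exact hdisj k l h
      · exact (hdisj l k h).symm
  have hJtop : ∀ n, J n ≠ ⊤ := fun n => by
    refine ne_top_of_le_ne_top hf.ne ((le_trans ?_ (hJsum (n + 1))))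
    rw [Finset.sum_range_succ]
    exact le_add_self
  let s : ℕ → ℝ := fun n => 2 * √2 * (J n).toReal + η / 2 ^ (n + 1)
  have hg : ∀ n, ∃ g : A.domain,
      ‖f - g‖ + e n * (‖(g : Y)‖ + ‖A g‖) ≤ √(e n) * s n := by
    intro n
    have h0 : 0 < √(e n) := Real.sqrt_pos.2 (he n)
    have h1 : kFunctional A (e n) f < ENNReal.ofReal (√(e n) * s n) := by
      refine (kFunctional_le_setLIntegral A f (he n)).trans_lt ?_
      change ENNReal.ofReal (2 * √2 * √(e n)) * J n < _
      rw [← ENNReal.ofReal_toReal (hJtop n), ← ENNReal.ofReal_mul (by positivity)]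
      refine (ENNReal.ofReal_lt_ofReal_iff_of_nonneg (by positivity)).2 ?_
      have h2 : 0 < √(e n) * (η / 2 ^ (n + 1)) := by positivity
      change 2 * √2 * √(e n) * (J n).toReal < √(e n) * (2 * √2 * (J n).toReal + η / 2 ^ (n + 1))
      linarith
    obtain ⟨g, hg⟩ := iInf_lt_iff.1 h1
    refine ⟨g, ?_⟩
    rw [← ofReal_norm, ← ofReal_norm, ← ofReal_norm,
      ← ENNReal.ofReal_add (norm_nonneg _) (norm_nonneg _), ← ENNReal.ofReal_mul (he n).le,
      ← ENNReal.ofReal_add (norm_nonneg _)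
        (mul_nonneg (he n).le (add_nonneg (norm_nonneg _) (norm_nonneg _)))] at hg
    exact ((ENNReal.ofReal_lt_ofReal_iff_of_nonneg (add_nonneg (norm_nonneg _)
      (mul_nonneg (he n).le (add_nonneg (norm_nonneg _) (norm_nonneg _))))).1 hg).le
  choose g hg using hg
  refine ⟨g, s, hg, fun n => by positivity, fun n => ?_⟩
  have h1 : ∑ k ∈ Finset.range n, (J k).toReal ≤ (interpNorm A f).toReal := by
    rw [← ENNReal.toReal_sum fun k _ => hJtop k]
    exact ENNReal.toReal_mono hf.ne (hJsum n)
  have h2 : ∑ k ∈ Finset.range n, η / 2 ^ (k + 1) ≤ η := by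
    have h3 : ∀ n, ∑ k ∈ Finset.range n, η / 2 ^ (k + 1) = η - η / 2 ^ n := by
      intro n
      induction n with
      | zero => simp
      | succ n ih => rw [Finset.sum_range_succ, ih, pow_succ]; field_simp; ring
    rw [h3]
    have : 0 < η / 2 ^ n := by positivity
    linarith
  rw [Finset.sum_add_distrib, ← Finset.mul_sum]
  exact add_le_add (mul_le_mul_of_nonneg_left h1 (by positivity)) h2

end Interpolation

section InterpolationBound

variable {X : Type*} [NormedAddCommGroup X] [NormedSpace ℂ X]

/-- A uniform bound for the regularized resolvents along the sequence `ε₀ / 2 ^ N`. -/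
theorem RegularizedFamily.norm_form_le_interpNorm {A : AntiDual X →ₗ.[ℂ] AntiDual X}
    {K : X →L[ℂ] AntiDual X} {C ε₀ : ℝ} (R : RegularizedFamily A K C ε₀) (hC : 0 ≤ C)
    (hε₀ : 0 < ε₀) (hCε : 4 * C * ε₀ ≤ 1) {f : AntiDual X} (hf : interpNorm A f < ⊤) (N : ℕ) :
    ‖f (R.G (ε₀ / 2 ^ N) f)‖ ≤
      (24 / ε₀ ^ 2 + 1204) * 8 * (interpNorm A f).toReal ^ 2 := by
  have h1 : ∀ η : ℝ, 0 < η → ‖f (R.G (ε₀ / 2 ^ N) f)‖ ≤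
      (24 / ε₀ ^ 2 + 1204) * (2 * √2 * (interpNorm A f).toReal + η) ^ 2 := by
    intro η hη
    obtain ⟨g, s, hg, hs, hT⟩ := exists_dyadic_approx A hf hε₀ hη
    exact R.norm_form_dyadic_le hC hε₀ hCε hg hs hT N
  have h2 : Tendsto (fun η : ℝ =>
      (24 / ε₀ ^ 2 + 1204) * (2 * √2 * (interpNorm A f).toReal + η) ^ 2) (𝓝[>] 0)
      (𝓝 ((24 / ε₀ ^ 2 + 1204) * (2 * √2 * (interpNorm A f).toReal + 0) ^ 2)) := by
    refine Tendsto.mono_left (Continuous.tendsto ?_ 0) nhdsWithin_le_nhds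
    fun_prop
  have h3 := ge_of_tendsto h2 (by filter_upwards [self_mem_nhdsWithin] with η hη using h1 η hη)
  refine h3.trans_eq ?_
  rw [add_zero, mul_pow, mul_pow, Real.sq_sqrt zero_le_two]
  ring

end InterpolationBound

/-! ### Invertibility of the regularized operator -/

section RegularizedOperator

variable {𝓗 : Type*} [NormedAddCommGroup 𝓗] [InnerProductSpace ℂ 𝓗]
variable {H : 𝓗 →ₗ.[ℂ] 𝓗}

/-- The operator `H - z - iεB` on the domain of `H`. -/
def regOp (B : H.domain →ₗ[ℂ] 𝓗) (ε : ℝ) (z : ℂ) : H.domain →ₗ[ℂ] 𝓗 :=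
  shift H z - (I * (ε : ℂ)) • B

theorem regOp_apply (B : H.domain →ₗ[ℂ] 𝓗) (ε : ℝ) (z : ℂ) (u : H.domain) :
    regOp B ε z u = shift H z u - (I * (ε : ℂ)) • B u := rfl

theorem inner_self_im_eq_zero {T : H.domain →ₗ[ℂ] 𝓗}
    (hT : ∀ u v : H.domain, ⟪T u, (v : 𝓗)⟫_ℂ = ⟪(u : 𝓗), T v⟫_ℂ) (u : H.domain) :
    (⟪(u : 𝓗), T u⟫_ℂ).im = 0 := by
  have h := hT u u
  rw [← inner_conj_symm] at h
  exact Complex.conj_eq_iff_im.1 h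

variable [CompleteSpace 𝓗]

theorem inner_regOp (hH : IsSelfAdjoint H) {B : H.domain →ₗ[ℂ] 𝓗}
    (hB : ∀ u v : H.domain, ⟪B u, (v : 𝓗)⟫_ℂ = ⟪(u : 𝓗), B v⟫_ℂ) (ε : ℝ) (z : ℂ)
    (u v : H.domain) :
    ⟪regOp B ε z u, (v : 𝓗)⟫_ℂ = ⟪(u : 𝓗), regOp B (-ε) (conj z) v⟫_ℂ := by
  rw [regOp_apply, regOp_apply, inner_sub_left, inner_sub_right, inner_shift hH, inner_smul_left,
    inner_smul_right, hB, map_mul, conj_I, conj_ofReal, ofReal_neg]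
  ring

/-- A symmetric operator defined on the domain of `H` is `H`-bounded. -/
theorem exists_comp_resolvent (hH : IsSelfAdjoint H) {B : H.domain →ₗ[ℂ] 𝓗}
    (hB : ∀ u v : H.domain, ⟪B u, (v : 𝓗)⟫_ℂ = ⟪(u : 𝓗), B v⟫_ℂ) {z : ℂ} (hz : z.im ≠ 0) :
    ∃ L : 𝓗 →L[ℂ] 𝓗, ∀ u : H.domain, L (shift H z u) = B u := by
  have hr : ∀ x, (((shiftEquiv hH hz).symm x : H.domain) : 𝓗) = resolventOp hH z hz x :=
    fun x => rfl
  refine ⟨ContinuousLinearMap.ofSeqClosedGraph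
    (g := B ∘ₗ (shiftEquiv hH hz).symm.toLinearMap) ?_, fun u => ?_⟩
  · intro u x y hu hy
    refine hH.dense_domain.eq_of_inner_right ℂ fun h hh => ?_
    have e : ∀ w, ⟪h, (B ∘ₗ (shiftEquiv hH hz).symm.toLinearMap) w⟫_ℂ =
        ⟪B ⟨h, hh⟩, resolventOp hH z hz w⟫_ℂ := fun w => (hB ⟨h, hh⟩ _).symm
    have h1 : Tendsto (fun n => ⟪h, (B ∘ₗ (shiftEquiv hH hz).symm.toLinearMap) (u n)⟫_ℂ) atTop
        (𝓝 ⟪h, y⟫_ℂ) := tendsto_const_nhds.inner hy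
    simp only [e] at h1
    have h2 := (tendsto_const_nhds (x := B ⟨h, hh⟩)).inner (𝕜 := ℂ)
      (((resolventOp hH z hz).continuous.tendsto x).comp hu)
    rw [e]
    exact tendsto_nhds_unique h1 h2
  · change B ((shiftEquiv hH hz).symm (shiftEquiv hH hz u)) = B u
    rw [LinearEquiv.symm_apply_apply]

theorem exists_relative_bound (hH : IsSelfAdjoint H) {B : H.domain →ₗ[ℂ] 𝓗}
    (hB : ∀ u v : H.domain, ⟪B u, (v : 𝓗)⟫_ℂ = ⟪(u : 𝓗), B v⟫_ℂ) :
    ∃ β : ℝ, 0 ≤ β ∧ ∀ u : H.domain, ‖B u‖ ≤ β * ‖shift H I u‖ := by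
  obtain ⟨L, hL⟩ := exists_comp_resolvent hH hB (z := I) I_im_ne
  exact ⟨‖L‖, norm_nonneg _, fun u => by rw [← hL]; exact L.le_opNorm _⟩

/-- The basic coercivity estimate. The real part of the form of `H - z - iεB` is added to its
imaginary part with the weight `c₁ε`, which turns `B` into `B - c₁H`; the leftover term
`c₁ ε λ ‖u‖²` has the right sign. -/
theorem regOp_coercive (hH : IsSelfAdjoint H) {B : H.domain →ₗ[ℂ] 𝓗}
    (hB : ∀ u v : H.domain, ⟪B u, (v : 𝓗)⟫_ℂ = ⟪(u : 𝓗), B v⟫_ℂ) {c₁ lam μ ε : ℝ}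
    (hc₁ : 0 ≤ c₁) (hlam : 0 ≤ c₁ * lam) (hs : (0 ≤ ε ∧ 0 ≤ μ) ∨ (ε ≤ 0 ∧ μ ≤ 0))
    (u : H.domain) :
    |μ| * ‖(u : 𝓗)‖ ^ 2 + |ε| * ((⟪(u : 𝓗), B u⟫_ℂ).re - c₁ * (⟪(u : 𝓗), H u⟫_ℂ).re) ≤
      (1 + |ε| * c₁) * ‖⟪(u : 𝓗), regOp B ε ⟨lam, μ⟩ u⟫_ℂ‖ := by
  set w := ⟪(u : 𝓗), regOp B ε ⟨lam, μ⟩ u⟫_ℂ with hw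
  have e : w = ⟪(u : 𝓗), H u⟫_ℂ - (⟨lam, μ⟩ : ℂ) * ((‖(u : 𝓗)‖ ^ 2 : ℝ) : ℂ) -
      (I * (ε : ℂ)) * ⟪(u : 𝓗), B u⟫_ℂ := by
    rw [hw, regOp_apply, shift_apply, inner_sub_right, inner_sub_right, inner_smul_right,
      inner_smul_right, inner_self_eq_norm_sq_to_K]
    simp
  have hbi := inner_self_im_eq_zero hB u
  have hhi := inner_self_im_eq_zero (T := H.toFun) (symm_of_isSelfAdjoint hH) u
  change (⟪(u : 𝓗), H u⟫_ℂ).im = 0 at hhi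
  set n := ‖(u : 𝓗)‖ ^ 2 with hn
  have hn0 : 0 ≤ n := sq_nonneg _
  have hre : w.re = (⟪(u : 𝓗), H u⟫_ℂ).re - lam * n := by
    rw [e]; simp [hbi, -Complex.ofReal_pow]
  have him : w.im = -μ * n - ε * (⟪(u : 𝓗), B u⟫_ℂ).re := by
    rw [e]; simp [hhi, -Complex.ofReal_pow]
  have h1 : |w.re| ≤ ‖w‖ := Complex.abs_re_le_norm w
  have h2 : |w.im| ≤ ‖w‖ := Complex.abs_im_le_norm w
  have h3 : 0 ≤ |ε| * (c₁ * lam) * n := by positivity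
  have h5 : |ε| * c₁ * -w.re ≤ |ε| * c₁ * ‖w‖ :=
    mul_le_mul_of_nonneg_left ((neg_le_abs _).trans h1) (by positivity)
  rw [hre] at h5
  rcases hs with ⟨hε, hμ⟩ | ⟨hε, hμ⟩
  · rw [abs_of_nonneg hε] at *
    rw [abs_of_nonneg hμ]
    have h6 := (neg_le_abs w.im).trans h2
    rw [him] at h6
    linarith
  · rw [abs_of_nonpos hε] at *
    rw [abs_of_nonpos hμ]
    have h6 := (le_abs_self w.im).trans h2
    rw [him] at h6
    linarith

/-- A bounded perturbation `1 - εL` along which the operator stays bounded below uniformly stays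
invertible. -/
theorem isUnit_one_sub_smul {L : 𝓗 →L[ℂ] 𝓗} {ε c : ℝ} (hc : 0 ≤ c)
    (h : ∀ r ∈ Set.Icc (0 : ℝ) 1, ∀ x, ‖x‖ ≤ c * ‖(1 - ((r * ε : ℝ) : ℂ) • L) x‖) :
    IsUnit (1 - ((ε : ℝ) : ℂ) • L) := by
  obtain ⟨m, hm⟩ := exists_nat_gt (c * (|ε| * ‖L‖))
  have hm0 : (0 : ℝ) < m := lt_of_le_of_lt (by positivity) hm
  have key : ∀ k : ℕ, k ≤ m → IsUnit (1 - (((k / m : ℝ) * ε : ℝ) : ℂ) • L) := by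
    intro k
    induction k with
    | zero => intro _; simp
    | succ k ih =>
      intro hk
      obtain ⟨P, hP⟩ := ih (Nat.le_of_succ_le hk)
      have hr : (k / m : ℝ) ∈ Set.Icc (0 : ℝ) 1 := by
        refine ⟨by positivity, (div_le_one hm0).2 ?_⟩
        exact_mod_cast Nat.le_of_succ_le hk
      have hinv : ‖(↑P⁻¹ : 𝓗 →L[ℂ] 𝓗)‖ ≤ c := by
        refine ContinuousLinearMap.opNorm_le_bound _ hc fun x => ?_
        have h1 := h _ hr ((↑P⁻¹ : 𝓗 →L[ℂ] 𝓗) x)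
        rw [← hP] at h1
        have h2 : (P : 𝓗 →L[ℂ] 𝓗) ((↑P⁻¹ : 𝓗 →L[ℂ] 𝓗) x) = x :=
          congrArg (fun Q : 𝓗 →L[ℂ] 𝓗 => Q x) P.mul_inv
        rwa [h2] at h1
      have e : (1 : 𝓗 →L[ℂ] 𝓗) - ((((k + 1 : ℕ) / m : ℝ) * ε : ℝ) : ℂ) • L =
          P * (1 - (↑P⁻¹ : 𝓗 →L[ℂ] 𝓗) * (((ε / m : ℝ) : ℂ) • L)) := by
        rw [mul_sub, mul_one, ← mul_assoc, P.mul_inv, one_mul, hP, sub_sub, ← add_smul,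
          ← Complex.ofReal_add]
        congr 4
        push_cast
        field_simp
      rw [e]
      refine P.isUnit.mul (isUnit_one_sub_of_norm_lt_one ?_)
      refine (norm_mul_le _ _).trans_lt ?_
      rw [norm_smul, Complex.norm_real, Real.norm_eq_abs, abs_div, abs_of_pos hm0]
      refine (mul_le_mul_of_nonneg_right hinv (by positivity)).trans_lt ?_
      rw [div_mul_eq_mul_div, ← mul_div_assoc, div_lt_one hm0]
      exact hm
  have h1 := key m le_rfl
  rwa [div_self hm0.ne', one_mul] at h1

/-- For small `ε` with the sign of `Im z`, the operator `H - z - iεB` is a bijection from the domain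
of `H` onto the Hilbert space. The smallness of `ε` does not depend on `z`: coercivity provides a
lower bound which is uniform along the way from `0` to `ε`. -/
theorem regOp_bijective (hH : IsSelfAdjoint H) {B : H.domain →ₗ[ℂ] 𝓗}
    (hB : ∀ u v : H.domain, ⟪B u, (v : 𝓗)⟫_ℂ = ⟪(u : 𝓗), B v⟫_ℂ) {c₁ lam μ ε β : ℝ}
    (hc₁ : 0 ≤ c₁) (hlam : 0 ≤ c₁ * lam) (hμ : μ ≠ 0)
    (hs : (0 ≤ ε ∧ 0 ≤ μ) ∨ (ε ≤ 0 ∧ μ ≤ 0))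
    (hq : ∀ u : H.domain, 0 ≤ (⟪(u : 𝓗), B u⟫_ℂ).re - c₁ * (⟪(u : 𝓗), H u⟫_ℂ).re)
    (hβ : ∀ u : H.domain, ‖B u‖ ≤ β * ‖shift H I u‖) (hεβ : |ε| * β ≤ 1 / 2)
    (hεc : |ε| * c₁ ≤ 1) : Function.Bijective (regOp B ε ⟨lam, μ⟩) := by
  set z : ℂ := ⟨lam, μ⟩ with hz
  have hμ0 : 0 < |μ| := abs_pos.2 hμ
  have hzim : z.im ≠ 0 := hμ
  -- the lower bound in the Hilbert space
  have low : ∀ r ∈ Set.Icc (0 : ℝ) 1, ∀ u : H.domain,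
      |μ| * ‖(u : 𝓗)‖ ≤ 2 * ‖regOp B (r * ε) z u‖ := by
    intro r hr u
    have hr1 : |r * ε| ≤ |ε| := by
      rw [abs_mul, abs_of_nonneg hr.1]
      exact mul_le_of_le_one_left (abs_nonneg _) hr.2
    have h1 := regOp_coercive hH hB hc₁ hlam (ε := r * ε) (μ := μ) (by
      rcases hs with ⟨h1, h2⟩ | ⟨h1, h2⟩
      · exact Or.inl ⟨mul_nonneg hr.1 h1, h2⟩
      · exact Or.inr ⟨mul_nonpos_of_nonneg_of_nonpos hr.1 h1, h2⟩) u
    have h2 : |r * ε| * c₁ ≤ 1 := (mul_le_mul_of_nonneg_right hr1 hc₁).trans hεc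
    have h3 : 0 ≤ |r * ε| * ((⟪(u : 𝓗), B u⟫_ℂ).re - c₁ * (⟪(u : 𝓗), H u⟫_ℂ).re) :=
      mul_nonneg (abs_nonneg _) (hq u)
    have h4 : ‖⟪(u : 𝓗), regOp B (r * ε) z u⟫_ℂ‖ ≤ ‖(u : 𝓗)‖ * ‖regOp B (r * ε) z u‖ :=
      norm_inner_le_norm _ _
    have h5 : (1 + |r * ε| * c₁) * ‖⟪(u : 𝓗), regOp B (r * ε) z u⟫_ℂ‖ ≤
        2 * (‖(u : 𝓗)‖ * ‖regOp B (r * ε) z u‖) :=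
      mul_le_mul (by linarith) h4 (norm_nonneg _) zero_le_two
    rcases (norm_nonneg (u : 𝓗)).eq_or_lt with h | h
    · rw [← h, mul_zero]; positivity
    · refine le_of_mul_le_mul_right ?_ h
      nlinarith
  -- the lower bound in the norm of the domain of `H`
  have low' : ∀ r ∈ Set.Icc (0 : ℝ) 1, ∀ u : H.domain,
      ‖shift H z u‖ ≤ (2 + ‖z - I‖ * (2 / |μ|)) * ‖regOp B (r * ε) z u‖ := by
    intro r hr u
    have h1 : ‖(u : 𝓗)‖ ≤ 2 / |μ| * ‖regOp B (r * ε) z u‖ := by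
      rw [div_mul_eq_mul_div, le_div_iff₀ hμ0, mul_comm]
      exact low r hr u
    have h2 : ‖shift H I u‖ ≤ ‖shift H z u‖ + ‖z - I‖ * ‖(u : 𝓗)‖ := by
      have e : shift H I u = shift H z u + (z - I) • (u : 𝓗) := by
        rw [shift_apply, shift_apply]; module
      rw [e, ← norm_smul]
      exact norm_add_le _ _
    have h3 : ‖shift H z u‖ ≤ ‖regOp B (r * ε) z u‖ + |r * ε| * ‖B u‖ := by
      have e : shift H z u = regOp B (r * ε) z u + (I * ((r * ε : ℝ) : ℂ)) • B u := by
        rw [regOp_apply]; abel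
      conv_lhs => rw [e]
      refine (norm_add_le _ _).trans_eq ?_
      rw [norm_smul, norm_mul, norm_I, one_mul, Complex.norm_real, Real.norm_eq_abs]
    have h4 : |r * ε| * ‖B u‖ ≤ 1 / 2 * ‖shift H I u‖ := by
      calc |r * ε| * ‖B u‖ ≤ |ε| * (β * ‖shift H I u‖) := by
            refine mul_le_mul ?_ (hβ u) (norm_nonneg _) (abs_nonneg _)
            rw [abs_mul, abs_of_nonneg hr.1]
            exact mul_le_of_le_one_left (abs_nonneg _) hr.2
        _ = |ε| * β * ‖shift H I u‖ := by ring
        _ ≤ _ := mul_le_mul_of_nonneg_right hεβ (norm_nonneg _)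
    have h5 := mul_le_mul_of_nonneg_left h1 (norm_nonneg (z - I))
    rw [add_mul, mul_assoc]
    linarith
  obtain ⟨L, hL⟩ := exists_comp_resolvent hH hB hzim
  have hP : ∀ (r : ℝ) (u : H.domain),
      (1 - ((r * ε : ℝ) : ℂ) • (I • L)) (shift H z u) = regOp B (r * ε) z u := by
    intro r u
    change shift H z u - ((r * ε : ℝ) : ℂ) • (I • L (shift H z u)) = _
    rw [hL, regOp_apply, smul_smul, mul_comm]
  have hU : IsUnit (1 - ((ε : ℝ) : ℂ) • (I • L)) := by
    refine isUnit_one_sub_smul (c := 2 + ‖z - I‖ * (2 / |μ|)) (by positivity) fun r hr x => ?_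
    obtain ⟨u, rfl⟩ := shift_surjective hH hzim x
    rw [hP]
    exact low' r hr u
  constructor
  · rw [injective_iff_map_eq_zero]
    intro u hu
    have h1 := low 1 ⟨zero_le_one, le_rfl⟩ u
    rw [one_mul, hu, norm_zero, mul_zero] at h1
    have h2 : ‖(u : 𝓗)‖ = 0 := by nlinarith [norm_nonneg (u : 𝓗)]
    simpa using h2
  · intro y
    obtain ⟨P, hP'⟩ := hU
    obtain ⟨u, hu⟩ := shift_surjective hH hzim ((↑P⁻¹ : 𝓗 →L[ℂ] 𝓗) y)
    refine ⟨u, ?_⟩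
    have h1 := hP 1 u
    rw [one_mul] at h1
    rw [← h1, hu, ← hP']
    exact congrArg (fun Q : 𝓗 →L[ℂ] 𝓗 => Q y) P.mul_inv

end RegularizedOperator

/-! ### Regularized resolvents on the energy space -/

section EnergyResolvent

variable {𝓗 : Type*} [NormedAddCommGroup 𝓗] [InnerProductSpace ℂ 𝓗] [CompleteSpace 𝓗]
variable {H : 𝓗 →ₗ.[ℂ] 𝓗}

theorem denseRange_invSqrtBracket (hH : IsSelfAdjoint H) : DenseRange (invSqrtBracket hH) := by
  have h1 : (LinearMap.range (invSqrtBracket hH).toLinearMap)ᗮ = ⊥ := by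
    rw [Submodule.eq_bot_iff]
    intro v hv
    rw [Submodule.mem_orthogonal] at hv
    apply invSqrtBracket_injective hH
    rw [map_zero, ← inner_self_eq_zero (𝕜 := ℂ)]
    have := hv (invSqrtBracket hH (invSqrtBracket hH v)) ⟨invSqrtBracket hH v, rfl⟩
    conv_lhs at this => rw [← star_invSqrtBracket, ContinuousLinearMap.star_eq_adjoint,
      ContinuousLinearMap.adjoint_inner_left, ← ContinuousLinearMap.star_eq_adjoint,
      star_invSqrtBracket]
    exact this
  exact Submodule.dense_iff_topologicalClosure_eq_top.2
    (Submodule.topologicalClosure_eq_top_iff.2 h1)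

theorem val_injective (hH : IsSelfAdjoint H) : Function.Injective (FormDomain.val hH) :=
  Subtype.val_injective

/-- The operator domain is dense in the form domain. -/
theorem denseRange_domainToForm (hH : IsSelfAdjoint H) : DenseRange (domainToForm hH) := by
  have h1 : DenseRange fun x => (sqrtBracketₗᵢ hH).symm (invSqrtBracket hH x) :=
    (sqrtBracketₗᵢ hH).symm.surjective.denseRange.comp (denseRange_invSqrtBracket hH)
      (sqrtBracketₗᵢ hH).symm.continuous
  refine h1.mono ?_
  rintro _ ⟨x, rfl⟩
  refine ⟨⟨invBracket hH x, (mem_domain_iff hH _).2 ⟨x, rfl⟩⟩, val_injective hH ?_⟩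
  rw [val_domainToForm, FormDomain.val_symm]
  change invBracket hH x = _
  rw [← invSqrtBracket_mul_self]
  rfl

theorem denseRange_toEnergy {E : Type*} [NormedAddCommGroup E] [NormedSpace ℂ E]
    (S : E →L[ℂ] AntiDual E) (hS : FormPos S) : DenseRange (toEnergy S hS) :=
  UniformSpace.Completion.denseRange_coe (α := PreEnergy S hS)

variable {hH : IsSelfAdjoint H} {S : FormDomain hH →L[ℂ] AntiDual (FormDomain hH)}
  {hSpos : FormPos S}

variable (S hSpos) in
/-- The pairs formed by a functional in the anti-dual of the energy space and a vector of the
Hilbert space which represent the same element of the anti-dual of the form domain. -/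
def commonPairs : Submodule ℂ (AntiDual (EnergySpace S hSpos) × 𝓗) :=
  LinearMap.eqLocus
    ((restrictForm S hSpos).toLinearMap ∘ₗ LinearMap.fst ℂ (AntiDual (EnergySpace S hSpos)) 𝓗)
    ((toAntiDual hH).toLinearMap ∘ₗ LinearMap.snd ℂ (AntiDual (EnergySpace S hSpos)) 𝓗)

theorem restrictForm_eq {φ : AntiDual (EnergySpace S hSpos)} {h : 𝓗}
    (hφ : (φ, h) ∈ commonPairs S hSpos) : restrictForm S hSpos φ = toAntiDual hH h := hφ

theorem mem_commonPairs_iff {φ : AntiDual (EnergySpace S hSpos)} {h : 𝓗} :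
    (φ, h) ∈ commonPairs S hSpos ↔
      ∀ g : FormDomain hH, φ (toEnergy S hSpos g) = ⟪FormDomain.val hH g, h⟫_ℂ := by
  constructor
  · intro hφ g
    rw [← toAntiDual_apply, ← restrictForm_eq hφ]
    rfl
  · intro hφ
    change restrictForm S hSpos φ = toAntiDual hH h
    ext g
    rw [toAntiDual_apply, ← hφ]
    rfl

theorem apply_toEnergy_domain {φ : AntiDual (EnergySpace S hSpos)} {h : 𝓗}
    (hφ : (φ, h) ∈ commonPairs S hSpos) (u : H.domain) :
    φ (toEnergy S hSpos (domainToForm hH u)) = ⟪(u : 𝓗), h⟫_ℂ :=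
  mem_commonPairs_iff.1 hφ _

/-- The functionals represented by vectors of the Hilbert space are dense in the anti-dual of the
energy space: they contain the Riesz representatives of the vectors in the domain of `H`. -/
theorem denseRange_commonPairs {S₀ : H.domain → 𝓗}
    (hS₀ : ∀ (u : H.domain) (g : FormDomain hH),
      S (domainToForm hH u) g = ⟪FormDomain.val hH g, S₀ u⟫_ℂ) :
    DenseRange fun p : commonPairs S hSpos => p.1.1 := by
  let J : EnergySpace S hSpos →L[ℂ] AntiDual (EnergySpace S hSpos) := (innerSL ℂ).flip
  have hJ : ∀ x y, J x y = ⟪y, x⟫_ℂ := fun x y => rfl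
  have hJs : Function.Surjective J := by
    obtain ⟨r, hr⟩ := exists_rieszVec (𝓗 := EnergySpace S hSpos)
    intro φ
    refine ⟨r φ, ?_⟩
    ext x
    rw [hJ, hr]
  have hd : DenseRange fun u : H.domain => J (toEnergy S hSpos (domainToForm hH u)) :=
    hJs.denseRange.comp ((denseRange_toEnergy S hSpos).comp (denseRange_domainToForm hH)
      (toEnergy S hSpos).continuous) J.continuous
  refine hd.mono ?_
  rintro _ ⟨u, rfl⟩
  refine ⟨⟨(J (toEnergy S hSpos (domainToForm hH u)), S₀ u), mem_commonPairs_iff.2 fun g => ?_⟩,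
    rfl⟩
  rw [hJ, ← hS₀]
  exact UniformSpace.Completion.inner_coe (𝕜 := ℂ) (E := PreEnergy S hSpos) g (domainToForm hH u)

variable (S hSpos) in
/-- `G` is the continuous extension, from the anti-dual of the energy space to the energy space, of
the inverse of the bijective operator `T` from the domain of `H` onto the Hilbert space. -/
structure IsEnergyInverse (T : H.domain →ₗ[ℂ] 𝓗)
    (G : AntiDual (EnergySpace S hSpos) →L[ℂ] EnergySpace S hSpos) : Prop where
  bijective : Function.Bijective T
  apply_of_mem : ∀ (φ : AntiDual (EnergySpace S hSpos)) (u : H.domain),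
    (φ, T u) ∈ commonPairs S hSpos → G φ = toEnergy S hSpos (domainToForm hH u)

theorem exists_extension_of_bound {E Y Z : Type*} [AddCommGroup E] [Module ℂ E]
    [NormedAddCommGroup Y] [NormedSpace ℂ Y] [NormedAddCommGroup Z] [NormedSpace ℂ Z]
    [CompleteSpace Z] (F : E →ₗ[ℂ] Z) (e : E →ₗ[ℂ] Y) (he : DenseRange e) {k : ℝ}
    (hk : ∀ x, ‖F x‖ ≤ k * ‖e x‖) : ∃ G : Y →L[ℂ] Z, ∀ x, G (e x) = F x :=
  ⟨F.extendOfNorm e, fun x => LinearMap.extendOfNorm_eq he ⟨k, hk⟩ x⟩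

theorem exists_isEnergyInverse {T : H.domain →ₗ[ℂ] 𝓗} (hT : Function.Bijective T)
    (hd : DenseRange fun p : commonPairs S hSpos => p.1.1) {k : ℝ}
    (hk : ∀ u : H.domain, ‖toEnergy S hSpos (domainToForm hH u)‖ ^ 2 ≤ k * ‖⟪(u : 𝓗), T u⟫_ℂ‖) :
    ∃ G, IsEnergyInverse S hSpos T G := by
  let Ti : 𝓗 →ₗ[ℂ] H.domain := (LinearEquiv.ofBijective T hT).symm.toLinearMap
  have hTi : ∀ h, T (Ti h) = h := fun h => (LinearEquiv.ofBijective T hT).apply_symm_apply h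
  have hTi' : ∀ u, Ti (T u) = u := fun u => (LinearEquiv.ofBijective T hT).symm_apply_apply u
  let e : commonPairs S hSpos →ₗ[ℂ] AntiDual (EnergySpace S hSpos) :=
    LinearMap.fst ℂ _ _ ∘ₗ (commonPairs S hSpos).subtype
  let F : commonPairs S hSpos →ₗ[ℂ] EnergySpace S hSpos :=
    (toEnergy S hSpos).toLinearMap ∘ₗ domainToForm hH ∘ₗ Ti ∘ₗ LinearMap.snd ℂ _ _ ∘ₗ
      (commonPairs S hSpos).subtype
  have hF : ∀ p : commonPairs S hSpos, F p = toEnergy S hSpos (domainToForm hH (Ti p.1.2)) :=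
    fun p => rfl
  have hbound : ∀ p, ‖F p‖ ≤ max k 0 * ‖e p‖ := by
    rintro ⟨⟨φ, h⟩, hp⟩
    rw [hF]
    change ‖toEnergy S hSpos (domainToForm hH (Ti h))‖ ≤ max k 0 * ‖φ‖
    set u := Ti h with hu
    have h1 := hk u
    rw [hu, hTi, ← apply_toEnergy_domain hp, ← hu] at h1
    have h2 := φ.le_opNorm (toEnergy S hSpos (domainToForm hH u))
    have h3 : k * ‖φ (toEnergy S hSpos (domainToForm hH u))‖ ≤
        max k 0 * (‖φ‖ * ‖toEnergy S hSpos (domainToForm hH u)‖) :=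
      mul_le_mul (le_max_left _ _) h2 (norm_nonneg _) (le_max_right _ _)
    rcases (norm_nonneg (toEnergy S hSpos (domainToForm hH u))).eq_or_lt with h0 | h0
    · rw [← h0]
      exact mul_nonneg (le_max_right _ _) (norm_nonneg _)
    · refine le_of_mul_le_mul_right ?_ h0
      linarith
  obtain ⟨G, hG⟩ := exists_extension_of_bound (E := commonPairs S hSpos)
    (Y := AntiDual (EnergySpace S hSpos)) (Z := EnergySpace S hSpos) F e hd hbound
  refine ⟨G, hT, fun φ u hφ => (hG ⟨(φ, T u), hφ⟩).trans ?_⟩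
  rw [hF]
  change toEnergy S hSpos (domainToForm hH (Ti (T u))) = _
  rw [hTi']

/-- Two continuous maps on the anti-dual of the energy space agree if they do so on the functionals
represented by vectors `T u`. -/
theorem eq_of_commonPairs {T : H.domain →ₗ[ℂ] 𝓗} (hT : Function.Surjective T)
    (hd : DenseRange fun p : commonPairs S hSpos => p.1.1) {Z : Type*} [TopologicalSpace Z]
    [T2Space Z] {a b : AntiDual (EnergySpace S hSpos) → Z} (ha : Continuous a) (hb : Continuous b)
    (h : ∀ φ u, (φ, T u) ∈ commonPairs S hSpos → a φ = b φ) (φ : AntiDual (EnergySpace S hSpos)) :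
    a φ = b φ := by
  refine hd.induction_on φ (isClosed_eq ha hb) ?_
  rintro ⟨⟨φ, h'⟩, hp⟩
  obtain ⟨u, rfl⟩ := hT h'
  exact h φ u hp

theorem le_of_commonPairs {T : H.domain →ₗ[ℂ] 𝓗} (hT : Function.Surjective T)
    (hd : DenseRange fun p : commonPairs S hSpos => p.1.1)
    {a b : AntiDual (EnergySpace S hSpos) → ℝ} (ha : Continuous a) (hb : Continuous b)
    (h : ∀ φ u, (φ, T u) ∈ commonPairs S hSpos → a φ ≤ b φ) (φ : AntiDual (EnergySpace S hSpos)) :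
    a φ ≤ b φ := by
  refine hd.induction_on φ (isClosed_le ha hb) ?_
  rintro ⟨⟨φ, h'⟩, hp⟩
  obtain ⟨u, rfl⟩ := hT h'
  exact h φ u hp

namespace IsEnergyInverse

theorem coercive {T : H.domain →ₗ[ℂ] 𝓗}
    {G : AntiDual (EnergySpace S hSpos) →L[ℂ] EnergySpace S hSpos}
    (hG : IsEnergyInverse S hSpos T G) (hd : DenseRange fun p : commonPairs S hSpos => p.1.1)
    {a : ℝ} (ha : ∀ u : H.domain, a * ‖toEnergy S hSpos (domainToForm hH u)‖ ^ 2 ≤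
      2 * ‖⟪(u : 𝓗), T u⟫_ℂ‖) (φ : AntiDual (EnergySpace S hSpos)) :
    a * ‖G φ‖ ^ 2 ≤ 2 * ‖φ (G φ)‖ := by
  have hc : Continuous fun φ : AntiDual (EnergySpace S hSpos) => φ (G φ) :=
    continuous_iff_continuousAt.2 fun φ => tendsto_antiDual_apply tendsto_id (G.continuous.tendsto φ)
  refine le_of_commonPairs hG.bijective.2 hd (a := fun φ => a * ‖G φ‖ ^ 2)
    (b := fun φ => 2 * ‖φ (G φ)‖) (by fun_prop) (hc.norm.const_mul 2) (fun φ u hφ => ?_) φ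
  rw [hG.apply_of_mem φ u hφ, apply_toEnergy_domain hφ]
  exact ha u

theorem adjoint {T T' : H.domain →ₗ[ℂ] 𝓗}
    {G G' : AntiDual (EnergySpace S hSpos) →L[ℂ] EnergySpace S hSpos}
    (hG : IsEnergyInverse S hSpos T G) (hG' : IsEnergyInverse S hSpos T' G')
    (hd : DenseRange fun p : commonPairs S hSpos => p.1.1)
    (hT : ∀ u v : H.domain, ⟪T u, (v : 𝓗)⟫_ℂ = ⟪(u : 𝓗), T' v⟫_ℂ)
    (φ ψ : AntiDual (EnergySpace S hSpos)) : ψ (G φ) = conj (φ (G' ψ)) := by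
  have hev : ∀ x, Continuous fun φ : AntiDual (EnergySpace S hSpos) => φ x := fun x =>
    continuous_iff_continuousAt.2 fun φ => tendsto_antiDual_apply tendsto_id tendsto_const_nhds
  refine eq_of_commonPairs hG.bijective.2 hd (a := fun φ => ψ (G φ))
    (b := fun φ => conj (φ (G' ψ))) (ψ.continuous.comp G.continuous)
    (continuous_conj.comp (hev _)) (fun φ u hφ => ?_) φ
  refine eq_of_commonPairs hG'.bijective.2 hd (a := fun ψ => ψ (G φ))
    (b := fun ψ => conj (φ (G' ψ))) (hev _)
    (continuous_conj.comp (φ.continuous.comp G'.continuous)) (fun ψ v hψ => ?_) ψ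
  rw [hG.apply_of_mem φ u hφ, hG'.apply_of_mem ψ v hψ, apply_toEnergy_domain hφ,
    apply_toEnergy_domain hψ, inner_conj_symm, hT]

/-- The resolvent equation for the regularized resolvents. -/
theorem sub_eq {B : H.domain →ₗ[ℂ] 𝓗} {z : ℂ} {ε δ : ℝ}
    {G₁ G₂ : AntiDual (EnergySpace S hSpos) →L[ℂ] EnergySpace S hSpos}
    (h₁ : IsEnergyInverse S hSpos (regOp B ε z) G₁) (h₂ : IsEnergyInverse S hSpos (regOp B δ z) G₂)
    (hd : DenseRange fun p : commonPairs S hSpos => p.1.1)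
    {K : EnergySpace S hSpos →L[ℂ] AntiDual (EnergySpace S hSpos)}
    (hK : ∀ u : H.domain, (K (toEnergy S hSpos (domainToForm hH u)), B u) ∈ commonPairs S hSpos)
    (φ : AntiDual (EnergySpace S hSpos)) :
    G₁ φ - G₂ φ = (I * ((ε - δ : ℝ) : ℂ)) • G₁ (K (G₂ φ)) := by
  refine eq_of_commonPairs h₂.bijective.2 hd (a := fun φ => G₁ φ - G₂ φ)
    (b := fun φ => (I * ((ε - δ : ℝ) : ℂ)) • G₁ (K (G₂ φ))) (G₁ - G₂).continuous
    ((G₁.comp (K.comp G₂)).continuous.const_smul (I * ((ε - δ : ℝ) : ℂ))) (fun φ u hφ => ?_) φ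
  rw [h₂.apply_of_mem φ u hφ]
  obtain ⟨v, hv⟩ := h₁.bijective.2 (regOp B δ z u)
  obtain ⟨w, hw⟩ := h₁.bijective.2 (B u)
  have hKu := hK u
  rw [← hv] at hφ
  rw [← hw] at hKu
  rw [h₁.apply_of_mem φ v hφ, h₁.apply_of_mem _ w hKu, ← map_sub, ← map_sub, ← map_smul,
    ← map_smul]
  congr 2
  apply h₁.bijective.1
  rw [map_sub, map_smul, hv, hw, regOp_apply, regOp_apply, ofReal_sub]
  module

/-- As `ε → 0`, for fixed `z`, the regularized resolvents converge in norm to the resolvent of `H`, at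
a rate proportional to `ε`. This uses that `B` is bounded from the form domain to its anti-dual. -/
theorem exists_norm_sub_resolventExt_le (hd : DenseRange fun p : commonPairs S hSpos => p.1.1)
    {B : H.domain →ₗ[ℂ] 𝓗} {B' : FormDomain hH →L[ℂ] AntiDual (FormDomain hH)}
    (hB' : ∀ u : H.domain, B' (domainToForm hH u) = toAntiDual hH (B u)) {z : ℂ}
    (hz : z.im ≠ 0) :
    ∃ κ > 0, ∃ M : ℝ, ∀ (ε : ℝ) (G : AntiDual (EnergySpace S hSpos) →L[ℂ] EnergySpace S hSpos),
      |ε| ≤ κ → IsEnergyInverse S hSpos (regOp B ε z) G → ∀ φ,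
        ‖G φ - toEnergy S hSpos (resolventExt hH z hz (restrictForm S hSpos φ))‖ ≤
          |ε| * M * ‖φ‖ := by
  set Q := resolventExt hH z hz with hQ
  set r := restrictForm S hSpos with hr
  set b := ‖B'‖ * ‖Q‖ with hb
  have hb0 : 0 ≤ b := by positivity
  refine ⟨1 / (2 * (b + 1)), by positivity, ‖toEnergy S hSpos‖ * (‖Q‖ * (b * (2 * ‖r‖))),
    fun ε G hε hG φ => ?_⟩
  have hεb : |ε| * b ≤ 1 / 2 := by
    rw [le_div_iff₀ (by positivity)] at hε
    nlinarith [abs_nonneg ε]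
  refine le_of_commonPairs hG.bijective.2 hd
    (a := fun φ => ‖G φ - toEnergy S hSpos (Q (r φ))‖)
    (b := fun φ => |ε| * (‖toEnergy S hSpos‖ * (‖Q‖ * (b * (2 * ‖r‖)))) * ‖φ‖)
    (by fun_prop) (by fun_prop) (fun φ u hφ => ?_) φ
  rw [hG.apply_of_mem φ u hφ, ← map_sub]
  -- `y` is `(H - z) u` as an element of the anti-dual of the form domain
  set y := toAntiDual hH (shift H z u) with hy
  have hQy : Q y = domainToForm hH u := by
    apply val_injective hH
    rw [hQ, hy, resolventExt_apply, resolventOp_shift, val_domainToForm]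
  have hyφ : y - r φ = (I * (ε : ℂ)) • B' (Q y) := by
    rw [hQy, hB', hr, restrictForm_eq hφ, hy, ← map_sub, ← map_smul, regOp_apply]
    congr 1
    abel
  have h1 : ‖y - r φ‖ ≤ |ε| * (b * ‖y‖) := by
    rw [hyφ, norm_smul, norm_mul, norm_I, one_mul, Complex.norm_real, Real.norm_eq_abs, hb,
      mul_assoc]
    refine mul_le_mul_of_nonneg_left ((B'.le_opNorm _).trans ?_) (abs_nonneg _)
    exact mul_le_mul_of_nonneg_left (Q.le_opNorm _) (norm_nonneg _)
  have h2 : ‖y‖ ≤ 2 * ‖r‖ * ‖φ‖ := by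
    have h3 : ‖y‖ ≤ ‖y - r φ‖ + ‖r φ‖ := by simpa using norm_add_le (y - r φ) (r φ)
    have h4 := r.le_opNorm φ
    have h5 : |ε| * (b * ‖y‖) ≤ 1 / 2 * ‖y‖ := by
      rw [← mul_assoc]
      exact mul_le_mul_of_nonneg_right hεb (norm_nonneg _)
    linarith
  have h3 : domainToForm hH u - Q (r φ) = Q (y - r φ) := by rw [map_sub, hQy]
  rw [h3]
  calc ‖toEnergy S hSpos (Q (y - r φ))‖ ≤ ‖toEnergy S hSpos‖ * (‖Q‖ * ‖y - r φ‖) :=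
        ((toEnergy S hSpos).le_opNorm _).trans
          (mul_le_mul_of_nonneg_left (Q.le_opNorm _) (norm_nonneg _))
    _ ≤ ‖toEnergy S hSpos‖ * (‖Q‖ * (|ε| * (b * (2 * ‖r‖ * ‖φ‖)))) := by
      gcongr
      exact h1.trans (by gcongr)
    _ = _ := by ring

end IsEnergyInverse

/-- A bound for the regularized resolvents along a sequence of parameters tending to `0` is
inherited by the resolvent. -/
theorem norm_pairing_resolventExt_le (hd : DenseRange fun p : commonPairs S hSpos => p.1.1)
    {B : H.domain →ₗ[ℂ] 𝓗} {B' : FormDomain hH →L[ℂ] AntiDual (FormDomain hH)}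
    (hB' : ∀ u : H.domain, B' (domainToForm hH u) = toAntiDual hH (B u)) {z : ℂ}
    (hz : z.im ≠ 0) {e : ℕ → ℝ} (he : Tendsto e atTop (𝓝 0))
    {G : ℕ → AntiDual (EnergySpace S hSpos) →L[ℂ] EnergySpace S hSpos}
    (hG : ∀ n, IsEnergyInverse S hSpos (regOp B (e n) z) (G n))
    {f : AntiDual (EnergySpace S hSpos)} {M : ℝ} (hM : ∀ n, ‖f (G n f)‖ ≤ M) :
    ‖pairing (restrictForm S hSpos f) (resolventExt hH z hz (restrictForm S hSpos f))‖ ≤ M := by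
  obtain ⟨κ, hκ, m, hm⟩ := IsEnergyInverse.exists_norm_sub_resolventExt_le hd hB' hz
  set x := resolventExt hH z hz (restrictForm S hSpos f) with hx
  have h1 : Tendsto (fun n => |e n| * m * ‖f‖) atTop (𝓝 0) := by
    have := (he.abs.mul_const m).mul_const ‖f‖
    simpa using this
  have h2 : Tendsto (fun n => G n f) atTop (𝓝 (toEnergy S hSpos x)) := by
    rw [tendsto_iff_norm_sub_tendsto_zero]
    refine squeeze_zero' (Eventually.of_forall fun n => norm_nonneg _) ?_ h1
    have h3 : ∀ᶠ n in atTop, |e n| < κ := by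
      have := he.abs
      rw [abs_zero] at this
      exact this.eventually (gt_mem_nhds hκ)
    filter_upwards [h3] with n hn
    exact hm (e n) (G n) hn.le (hG n) f
  have h3 := le_of_tendsto' ((f.continuous.tendsto _).comp h2).norm hM
  rw [pairing, RCLike.norm_conj]
  exact h3

end EnergyResolvent

/-! ### Covariance under the group, and the resolvent estimate -/

section Covariance

variable {𝓗 : Type*} [NormedAddCommGroup 𝓗] [InnerProductSpace ℂ 𝓗] [CompleteSpace 𝓗]
variable {H : 𝓗 →ₗ.[ℂ] 𝓗} {W : C0Group 𝓗}

theorem conjugated_add (hinv : ∀ t, ∀ f ∈ H.domain, W t f ∈ H.domain) (s t : ℝ) (u : H.domain) :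
    conjugated hinv (s + t) u = W (-s) (conjugated hinv t ⟨W s u, hinv s u u.2⟩) := by
  have h1 : W (s + t) (u : 𝓗) = W t (W s u) := by
    rw [add_comm, W.map_add]; rfl
  have h2 : ∀ x, W (-(s + t)) x = W (-s) (W (-t) x) := fun x => by
    rw [neg_add, W.map_add]; rfl
  rw [conjugated_apply, conjugated_apply, h2]
  congr 4

theorem hasDerivAt_conjugated {hinv : ∀ t, ∀ f ∈ H.domain, W t f ∈ H.domain}
    (hC1 : DomainIsC1 hinv) (s : ℝ) (u : H.domain) :
    HasDerivAt (fun t => conjugated hinv t u)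
      (W (-s) (commutator hinv hC1 ⟨W s u, hinv s u u.2⟩)) s := by
  set v : H.domain := ⟨W s u, hinv s u u.2⟩ with hv
  have h1 : HasDerivAt (fun t => conjugated hinv t v) (commutator hinv hC1 v) (s - s) := by
    rw [sub_self]
    exact (hC1 v 0).hasDerivAt
  have h2 := ((W (-s)).restrictScalars ℝ).hasFDerivAt.comp_hasDerivAt s (h1.comp_sub_const s s)
  refine h2.congr_of_eventuallyEq (Eventually.of_forall fun t => ?_)
  change conjugated hinv t u = W (-s) (conjugated hinv (t - s) v)
  rw [hv, ← conjugated_add, add_sub_cancel]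

variable {hH : IsSelfAdjoint H} {S : FormDomain hH →L[ℂ] AntiDual (FormDomain hH)}
  {hSpos : FormPos S} {hW : ∀ t, W t ∈ unitary (𝓗 →L[ℂ] 𝓗)}
  {hinv : ∀ t, ∀ f ∈ H.domain, W t f ∈ H.domain} {V : C0Group (EnergySpace S hSpos)}

theorem formGroup_domainToForm (t : ℝ) (u : H.domain) :
    formGroup hH hW hinv t (domainToForm hH u) = domainToForm hH ⟨W t u, hinv t u u.2⟩ := rfl

theorem dualGroup_mem_commonPairs
    (hV : ∀ t f, V t (toEnergy S hSpos f) = toEnergy S hSpos (formGroup hH hW hinv t f)) (t : ℝ)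
    {φ : AntiDual (EnergySpace S hSpos)} {h : 𝓗} (hφ : (φ, h) ∈ commonPairs S hSpos) :
    (dualGroup V t φ, W t h) ∈ commonPairs S hSpos := by
  rw [mem_commonPairs_iff] at hφ ⊢
  intro g
  rw [dualGroup_apply, hV, hφ, val_formGroup, inner_group hW, neg_neg]

variable {hC1 : DomainIsC1 hinv} {K : EnergySpace S hSpos →L[ℂ] AntiDual (EnergySpace S hSpos)}

theorem formCommutator_domainToForm (u : H.domain) :
    formCommutator hH hW hinv hC1 (domainToForm hH u) =
      toAntiDual hH (commutator hinv hC1 u) := by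
  ext g
  rw [formCommutator_apply, toAntiDual_apply]

theorem commutator_mem_commonPairs
    (hK : ∀ f g : FormDomain hH,
      K (toEnergy S hSpos g) (toEnergy S hSpos f) = formCommutator hH hW hinv hC1 g f)
    (u : H.domain) :
    (K (toEnergy S hSpos (domainToForm hH u)), commutator hinv hC1 u) ∈ commonPairs S hSpos := by
  rw [mem_commonPairs_iff]
  intro g
  rw [hK, formCommutator_apply]

theorem conjForm_toEnergy
    (hV : ∀ t f, V t (toEnergy S hSpos f) = toEnergy S hSpos (formGroup hH hW hinv t f))
    (hK : ∀ f g : FormDomain hH,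
      K (toEnergy S hSpos g) (toEnergy S hSpos f) = formCommutator hH hW hinv hC1 g f)
    (t : ℝ) (u : H.domain) (g : FormDomain hH) :
    conjForm V K t (toEnergy S hSpos (domainToForm hH u)) (toEnergy S hSpos g) =
      ⟪FormDomain.val hH g, W (-t) (commutator hinv hC1 ⟨W t u, hinv t u u.2⟩)⟫_ℂ := by
  rw [conjForm_apply, hV, hV, hK, formGroup_domainToForm, formCommutator_apply, val_formGroup,
    inner_group hW]

/-- On the domain of `H`, the operator `increment V K ε t` is the increment of the regularized
operator under conjugation by the group. -/
theorem increment_mem_commonPairs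
    (hV : ∀ t f, V t (toEnergy S hSpos f) = toEnergy S hSpos (formGroup hH hW hinv t f))
    (hK : ∀ f g : FormDomain hH,
      K (toEnergy S hSpos g) (toEnergy S hSpos f) = formCommutator hH hW hinv hC1 g f)
    (hKC1 : IsC1 V (dualGroup V) K) (ε : ℝ) (z : ℂ) (t : ℝ) (u : H.domain) :
    (increment V K ε t (toEnergy S hSpos (domainToForm hH u)),
      W (-t) (regOp (commutator hinv hC1) ε z ⟨W t u, hinv t u u.2⟩) -
        regOp (commutator hinv hC1) ε z u) ∈ commonPairs S hSpos := by
  rw [mem_commonPairs_iff]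
  intro g
  set x := toEnergy S hSpos (domainToForm hH u) with hx
  have hcont := continuous_conjForm hKC1 x
  have h1 : (∫ s in (0 : ℝ)..t, conjForm V K s x) (toEnergy S hSpos g) =
      ∫ s in (0 : ℝ)..t, conjForm V K s x (toEnergy S hSpos g) :=
    ((ContinuousLinearMap.apply' ℂ (starRingEnd ℂ)
      (toEnergy S hSpos g)).intervalIntegral_comp_comm (hcont.intervalIntegrable 0 t)).symm
  have hcont' : Continuous fun s => conjForm V K s x (toEnergy S hSpos g) :=
    continuous_iff_continuousAt.2 fun s =>
      tendsto_antiDual_apply (hcont.tendsto s) tendsto_const_nhds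
  have h2 : ∫ s in (0 : ℝ)..t, conjForm V K s x (toEnergy S hSpos g) =
      ⟪FormDomain.val hH g, conjugated hinv t u⟫_ℂ -
        ⟪FormDomain.val hH g, conjugated hinv 0 u⟫_ℂ := by
    refine intervalIntegral.integral_eq_sub_of_hasDerivAt
      (f := fun s => ⟪FormDomain.val hH g, conjugated hinv s u⟫_ℂ) (fun s _ => ?_)
      (hcont'.intervalIntegrable 0 t)
    have h3 := (hasDerivAt_const s (FormDomain.val hH g)).inner ℂ (hasDerivAt_conjugated hC1 s u)
    rw [inner_zero_left, add_zero] at h3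
    rw [conjForm_toEnergy hV hK]
    exact h3
  have h0 : conjugated hinv 0 u = H u := by
    have h3 : ∀ y, W 0 y = y := fun y => by rw [W.map_zero]; rfl
    rw [conjugated_apply, neg_zero, h3]
    congr 1
    exact Subtype.ext (h3 _)
  have h4 : K x (toEnergy S hSpos g) = ⟪FormDomain.val hH g, commutator hinv hC1 u⟫_ℂ := by
    rw [hx, hK, formCommutator_apply]
  rw [increment, sub_apply, smul_apply, sub_apply, h1, h2, h0, conjForm_toEnergy hV hK, h4,
    smul_eq_mul, ← inner_sub_right, ← inner_sub_right, ← inner_smul_right, ← inner_sub_right]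
  congr 1
  rw [conjugated_apply, regOp_apply, regOp_apply, shift_apply, shift_apply, map_sub, map_sub,
    map_smul, map_smul]
  simp only
  rw [W.neg_apply_apply]
  module

/-- The conjugation of a regularized resolvent by the group. -/
theorem IsEnergyInverse.apply_dualGroup_sub
    (hd : DenseRange fun p : commonPairs S hSpos => p.1.1)
    (hV : ∀ t f, V t (toEnergy S hSpos f) = toEnergy S hSpos (formGroup hH hW hinv t f))
    (hK : ∀ f g : FormDomain hH,
      K (toEnergy S hSpos g) (toEnergy S hSpos f) = formCommutator hH hW hinv hC1 g f)
    (hKC1 : IsC1 V (dualGroup V) K) {ε : ℝ} {z : ℂ}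
    {G : AntiDual (EnergySpace S hSpos) →L[ℂ] EnergySpace S hSpos}
    (hG : IsEnergyInverse S hSpos (regOp (commutator hinv hC1) ε z) G) (t : ℝ)
    (φ : AntiDual (EnergySpace S hSpos)) :
    G (dualGroup V t φ) - V t (G φ) = -G (dualGroup V t (increment V K ε t (G φ))) := by
  refine eq_of_commonPairs hG.bijective.2 hd (a := fun φ => G (dualGroup V t φ) - V t (G φ))
    (b := fun φ => -G (dualGroup V t (increment V K ε t (G φ))))
    (G.comp (dualGroup V t) - (V t).comp G).continuous
    ((G.comp (dualGroup V t)).continuous.comp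
      ((continuous_increment hKC1 ε t).comp G.continuous)).neg (fun φ u hφ => ?_) φ
  have h1 := dualGroup_mem_commonPairs hV t hφ
  have h2 := dualGroup_mem_commonPairs hV t (increment_mem_commonPairs hV hK hKC1 ε z t u)
  rw [map_sub, W.apply_neg_apply] at h2
  obtain ⟨v, hv⟩ := hG.bijective.2 (W t (regOp (commutator hinv hC1) ε z u))
  set u' : H.domain := ⟨W t u, hinv t u u.2⟩ with hu'
  rw [← hv] at h1 h2
  rw [← map_sub] at h2
  rw [hG.apply_of_mem φ u hφ, hV, formGroup_domainToForm, ← hu', hG.apply_of_mem _ v h1,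
    hG.apply_of_mem _ (u' - v) h2, ← map_sub, ← map_sub, ← map_neg, ← map_neg, neg_sub]

end Covariance

end ConjugateOperator

end

open ConjugateOperator in

theorem theorem2p1 {𝓗 : Type*} [NormedAddCommGroup 𝓗] [InnerProductSpace ℂ 𝓗] [CompleteSpace 𝓗]
    -- the self-adjoint operator `H`
    (H : 𝓗 →ₗ.[ℂ] 𝓗) (hH : IsSelfAdjoint H)
    -- the strongly continuous unitary group `W`, which leaves the domain of `H` invariant
    (W : C0Group 𝓗) (hW : ∀ t, W t ∈ unitary (𝓗 →L[ℂ] 𝓗))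
    (hinv : ∀ t, ∀ f ∈ H.domain, W t f ∈ H.domain)
    -- `H` is of class `C¹(A; D(H), 𝓗)`
    (hC1 : DomainIsC1 hinv)
    -- the positivity assumptions
    (c₁ c₂ : ℝ) (hc₁ : 0 ≤ c₁) (hc₂ : 0 < c₂)
    (S : FormDomain hH →L[ℂ] AntiDual (FormDomain hH))
    (hS : S = -(c₁ : ℂ) • formOp hH + formCommutator hH hW hinv hC1)
    (hSpos : FormPos S)
    (hbelow : ∀ f : FormDomain hH,
      -c₂ * ‖FormDomain.val hH f‖ ^ 2 ≤ (formCommutator hH hW hinv hC1 f f).re)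
    -- `W` extends to a `C₀`-group `V` in the completion of the form domain for the norm of `S`
    (V : C0Group (EnergySpace S hSpos))
    (hV : ∀ t f, V t (toEnergy S hSpos f) = toEnergy S hSpos (formGroup hH hW hinv t f))
    -- `[iH, A]` extends to an element `K` of `C¹(A; 𝓢, 𝓢*)`
    (K : EnergySpace S hSpos →L[ℂ] AntiDual (EnergySpace S hSpos))
    (hK : ∀ f g : FormDomain hH,
      K (toEnergy S hSpos g) (toEnergy S hSpos f) = formCommutator hH hW hinv hC1 g f)
    (hKC1 : IsC1 V (dualGroup V) K) :
    ∃ c : ℝ, ∀ lam μ : ℝ, 0 ≤ c₁ * lam → ∀ hμ : 0 < μ,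
      ∀ f : AntiDual (EnergySpace S hSpos), interpNorm (generator (dualGroup V)) f < ⊤ →
        ‖pairing (restrictForm S hSpos f)
            (resolventExt hH ⟨lam, μ⟩ hμ.ne' (restrictForm S hSpos f))‖
          ≤ c * (interpNorm (generator (dualGroup V)) f).toReal ^ 2 ∧
        ‖pairing (restrictForm S hSpos f)
            (resolventExt hH ⟨lam, -μ⟩ (neg_ne_zero.2 hμ.ne') (restrictForm S hSpos f))‖
          ≤ c * (interpNorm (generator (dualGroup V)) f).toReal ^ 2 := by
  set B := commutator hinv hC1 with hBdef
  have hB := commutator_symm hH hW hinv hC1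
  -- the form of `S` on the domain of `H`
  have hS₀ : ∀ (u : H.domain) (g : FormDomain hH),
      S (domainToForm hH u) g = inner ℂ (FormDomain.val hH g) (B u - (c₁ : ℂ) • H u) := by
    intro u g
    rw [hS, add_apply, add_apply, smul_apply, smul_apply, formOp_apply, formCommutator_apply,
      inner_sub_right, inner_smul_right, smul_eq_mul]
    ring
  have hd := denseRange_commonPairs (hSpos := hSpos) hS₀
  have hnorm : ∀ u : H.domain, ‖toEnergy S hSpos (domainToForm hH u)‖ ^ 2 =
      (inner ℂ (u : 𝓗) (B u)).re - c₁ * (inner ℂ (u : 𝓗) (H u)).re := by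
    intro u
    rw [norm_toEnergy_sq, hS₀, val_domainToForm, inner_sub_right, inner_smul_right,
      Complex.sub_re, Complex.re_ofReal_mul]
  have hq : ∀ u : H.domain,
      0 ≤ (inner ℂ (u : 𝓗) (B u)).re - c₁ * (inner ℂ (u : 𝓗) (H u)).re := fun u => by
    rw [← hnorm]; positivity
  obtain ⟨β, hβ0, hβ⟩ := exists_relative_bound hH hB
  obtain ⟨K', hK'⟩ := exists_hasDerivAt_conjForm hKC1
  -- the range of the regularization parameter, independent of the spectral parameter
  set ε₀ : ℝ := 1 / (2 * β + c₁ + 4 * ‖K'‖ + 1) with hε₀def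
  have hden : 0 < 2 * β + c₁ + 4 * ‖K'‖ + 1 := by positivity
  have hε₀ : 0 < ε₀ := by positivity
  have hε₀den : ε₀ * (2 * β + c₁ + 4 * ‖K'‖ + 1) = 1 := by
    rw [hε₀def]; field_simp
  have hprod1 : 0 ≤ ε₀ * β := by positivity
  have hprod2 : 0 ≤ ε₀ * c₁ := by positivity
  have hprod3 : 0 ≤ ε₀ * ‖K'‖ := by positivity
  have hβε : ε₀ * β ≤ 1 / 2 := by linarith
  have hcε : ε₀ * c₁ ≤ 1 := by linarith
  have hCε : 4 * ‖K'‖ * ε₀ ≤ 1 := by linarith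
  refine ⟨(24 / ε₀ ^ 2 + 1204) * 8, fun lam μ hlam hμ f hf => ?_⟩
  -- the regularized resolvents
  have hcoer : ∀ ε ν : ℝ, |ε| ≤ ε₀ → (0 ≤ ε ∧ 0 ≤ ν) ∨ (ε ≤ 0 ∧ ν ≤ 0) → ∀ u : H.domain,
      |ε| * ‖toEnergy S hSpos (domainToForm hH u)‖ ^ 2 ≤
        2 * ‖inner ℂ (u : 𝓗) (regOp B ε ⟨lam, ν⟩ u)‖ := by
    intro ε ν hε hs u
    have h1 := regOp_coercive hH hB hc₁ hlam hs u
    rw [← hBdef, ← hnorm] at h1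
    have h2 : |ε| * c₁ ≤ 1 := (mul_le_mul_of_nonneg_right hε hc₁).trans hcε
    have h3 : 0 ≤ |ν| * ‖(u : 𝓗)‖ ^ 2 := by positivity
    have h4 := mul_le_mul_of_nonneg_right (show 1 + |ε| * c₁ ≤ 2 by linarith)
      (norm_nonneg (inner ℂ (u : 𝓗) (regOp B ε ⟨lam, ν⟩ u)))
    linarith
  have hex : ∀ ε ν : ℝ, ε ≠ 0 → ν ≠ 0 → |ε| ≤ ε₀ → (0 ≤ ε ∧ 0 ≤ ν) ∨ (ε ≤ 0 ∧ ν ≤ 0) →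
      ∃ G, IsEnergyInverse S hSpos (regOp B ε ⟨lam, ν⟩) G := by
    intro ε ν hε0 hν hε hs
    refine exists_isEnergyInverse
      (regOp_bijective hH hB hc₁ hlam hν hs hq hβ
        ((mul_le_mul_of_nonneg_right hε hβ0).trans hβε)
        ((mul_le_mul_of_nonneg_right hε hc₁).trans hcε)) hd (k := 2 / |ε|) fun u => ?_
    rw [div_mul_eq_mul_div, le_div_iff₀ (abs_pos.2 hε0), mul_comm]
    exact hcoer ε ν hε hs u
  have hexG : ∀ ε : ℝ, ∃ G, ε ∈ Set.Ioc 0 ε₀ →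
      IsEnergyInverse S hSpos (regOp B ε ⟨lam, μ⟩) G := by
    intro ε
    by_cases hε : ε ∈ Set.Ioc 0 ε₀
    · obtain ⟨G, hG⟩ := hex ε μ hε.1.ne' hμ.ne' (by rw [abs_of_pos hε.1]; exact hε.2)
        (Or.inl ⟨hε.1.le, hμ.le⟩)
      exact ⟨G, fun _ => hG⟩
    · exact ⟨0, fun h => absurd h hε⟩
  have hexG' : ∀ ε : ℝ, ∃ G, ε ∈ Set.Ioc 0 ε₀ →
      IsEnergyInverse S hSpos (regOp B (-ε) ⟨lam, -μ⟩) G := by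
    intro ε
    by_cases hε : ε ∈ Set.Ioc 0 ε₀
    · obtain ⟨G, hG⟩ := hex (-ε) (-μ) (neg_ne_zero.2 hε.1.ne') (neg_ne_zero.2 hμ.ne')
        (by rw [abs_neg, abs_of_pos hε.1]; exact hε.2)
        (Or.inr ⟨neg_nonpos.2 hε.1.le, neg_nonpos.2 hμ.le⟩)
      exact ⟨G, fun _ => hG⟩
    · exact ⟨0, fun h => absurd h hε⟩
  choose G hG using hexG
  choose G' hG' using hexG'
  have hadj : ∀ ε ∈ Set.Ioc 0 ε₀, ∀ φ ψ : AntiDual (EnergySpace S hSpos),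
      ψ (G ε φ) = starRingEnd ℂ (φ (G' ε ψ)) := fun ε hε =>
    (hG ε hε).adjoint (hG' ε hε) hd fun u v => inner_regOp hH hB ε ⟨lam, μ⟩ u v
  let R : RegularizedFamily (generator (dualGroup V)) K ‖K'‖ ε₀ :=
    { G := G
      G' := G'
      adj := hadj
      coercive := fun ε hε => (hG ε hε).coercive hd fun u => by
        have := hcoer ε μ (by rw [abs_of_pos hε.1]; exact hε.2) (Or.inl ⟨hε.1.le, hμ.le⟩) u
        rwa [abs_of_pos hε.1] at this
      coercive' := fun ε hε => (hG' ε hε).coercive hd fun u => by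
        have := hcoer (-ε) (-μ) (by rw [abs_neg, abs_of_pos hε.1]; exact hε.2)
          (Or.inr ⟨neg_nonpos.2 hε.1.le, neg_nonpos.2 hμ.le⟩) u
        rwa [abs_neg, abs_of_pos hε.1] at this
      resolvent_sub := fun ε hε δ hδ => (hG ε hε).sub_eq (hG δ hδ) hd
        (commutator_mem_commonPairs hK)
      form_commutator_le := fun ε hε h => norm_form_commutator_le hKC1 hK' hε.1.le (hadj ε hε)
        ((hG ε hε).apply_dualGroup_sub hd hV hK hKC1) h }
  have hbound := R.norm_form_le_interpNorm (norm_nonneg K') hε₀ hCε hf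
  -- the limit `ε → 0` along the sequence `ε₀ / 2 ^ N`
  have hmem : ∀ N : ℕ, ε₀ / 2 ^ N ∈ Set.Ioc 0 ε₀ := fun N =>
    ⟨RegularizedFamily.dyadic_pos hε₀ N, RegularizedFamily.dyadic_le hε₀ N⟩
  have he : Filter.Tendsto (fun N : ℕ => ε₀ / 2 ^ N) Filter.atTop (nhds 0) :=
    Filter.Tendsto.const_div_atTop (tendsto_pow_atTop_atTop_of_one_lt one_lt_two) ε₀
  have hcomm : ∀ u : H.domain, formCommutator hH hW hinv hC1 (domainToForm hH u) =
      toAntiDual hH (B u) := formCommutator_domainToForm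
  have he' : Filter.Tendsto (fun N : ℕ => -(ε₀ / 2 ^ N)) Filter.atTop (nhds 0) := by
    simpa using he.neg
  refine ⟨norm_pairing_resolventExt_le hd hcomm hμ.ne' he (fun N => hG _ (hmem N)) hbound,
    norm_pairing_resolventExt_le hd hcomm _ he' (fun N => hG' _ (hmem N)) fun N => ?_⟩
  -- the bounds for the adjoints are the same
  exact (R.norm_form_adj (hmem N) f).trans_le (hbound N)
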